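/- Let $\mathbb H$ be a separable real Hilbert space with its Borel $\sigma$-field (for instance $\mathbb H=L^2([0,1],\mathbb R)$), let $Q$ be a Borel probability measure on $\mathbb H$ with $\int_{\mathbb H}\|f\|^4\,Q(\mathrm df)<\infty$, and let $L^2_Q$ be the Hilbert space of ($Q$-classes of) measurable functions $\mathbb H\to\mathbb R$ that are square integrable with respect to $Q$. Let $X_1,X_2,\ldots$ be i.i.d. copies of a random element $X$ of $\mathbb H$ with $\mathbb E\|X\|^4<\infty$. Put $\mu=\mathbb E X$ and $Y=X-\mu$ (so $Y=X$ if $X$ is centred), let $\mathcal C f=\mathbb E(\langle X-\mu,f\rangle X)$ be the covariance operator of $X$ (and of $Y$), and $\sigma_f^2=\langle \mathcal C f,f\rangle$. With $$\overline X_n=\frac1n\sum_{j=1}^nX_j,\qquad \mathcal C_nf=\frac1n\sum_{j=1}^n\langle X_j-\overline X_n,f\rangle\,(X_j-\overline X_n),$$ define, for $f\in\mathbb H$, $$V_n(f)=\frac1{\sqrt n}\sum_{j=1}^n\Big\{\cos\langle f,X_j-\overline X_n\rangle+\sin\langle f,X_j-\overline X_n\rangle-\exp\big(-\tfrac12\langle\mathcal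 C_nf,f\rangle\big)\Big\},\qquad V_n^\star(f)=\frac{V_n(f)}{\sqrt n},$$ $$z(f)=\mathbb E\cos\langle f,Y\rangle+\mathbb E\sin\langle f,Y\rangle-\exp\big(-\tfrac12\sigma_f^2\big),$$ and, for $f,x\in\mathbb H$, $$\begin{aligned}\xi(f,x)={}&\cos\langle f,x\rangle-\mathbb E\cos\langle f,Y\rangle+\sin\langle f,x\rangle-\mathbb E\sin\langle f,Y\rangle\\&+\langle f,x\rangle\,\mathbb E\big[\sin\langle f,Y\rangle-\cos\langle f,Y\rangle\big]+\tfrac12e^{-\sigma_f^2/2}\big(\langle f,x\rangle^2-\sigma_f^2\big).\end{aligned}$$ Then the functions $\sqrt n\,(V_n^\star-z)$ define random elements of $L^2_Q$, and there is a centred Gaussian random element $\mathcal V^\star$ of $L^2_Q$ with covariance kernel $$K^\star(f,g)=\mathbb E[\xi(f,Y)\,\xi(g,Y)],\qquad f,g\in\mathbb H,$$ that is, $\mathbb E[\langle\mathcal V^\star,\Phi\rangle_Q\langle\mathcal V^\star,\Psi\rangle_Q]=\iint K^\star(f,g)\,\Phi(f)\,\Psi(g)\,Q(\mathrm df)\,Q(\mathrm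 dg)$ for all $\Phi,\Psi\in L^2_Q$, such that $$\sqrt n\,(V_n^\star-z)\ \longrightarrow\ \mathcal V^\star\quad\text{in distribution in }L^2_Q\text{ as }n\to\infty .$$ -/

import Mathlib

open MeasureTheory ProbabilityTheory Filter
open scoped RealInnerProductSpace

universe u v


noncomputable section

/-- The Hilbert space `L²_Q` of (classes of) real functions on `H`, square integrable under `Q`. -/
abbrev L2Q {H : Type*} [MeasurableSpace H] (Q : Measure H) : Type _ := Lp ℝ 2 Q

/-- `L²_Q` carries its Borel `σ`-algebra. -/
instance instMeasurableSpaceL2Q {H : Type*} [MeasurableSpace H] (Q : Measure H) :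
    MeasurableSpace (L2Q Q) := borel _

instance instBorelSpaceL2Q {H : Type*} [MeasurableSpace H] (Q : Measure H) :
    BorelSpace (L2Q Q) := ⟨rfl⟩

section Sample

variable {H : Type*} [NormedAddCommGroup H] [InnerProductSpace ℝ H]

/-- The sample mean of the first `n` members of the sequence `x`. -/
def sampleMean (n : ℕ) (x : ℕ → H) : H :=
  (n : ℝ)⁻¹ • ∑ j ∈ Finset.range n, x j

/-- The sample covariance operator (with divisor `n`) of the first `n` members of `x`; in
`L²([0,1])` it is the integral operator whose kernel is the sample covariance function. -/
def sampleCov (n : ℕ) (x : ℕ → H) (f : H) : H :=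
  (n : ℝ)⁻¹ • ∑ j ∈ Finset.range n, ⟪x j - sampleMean n x, f⟫ • (x j - sampleMean n x)

/-- The function `V_n` on `H`, evaluated at the data `x 0, …, x (n - 1)`. -/
def Vn (n : ℕ) (x : ℕ → H) (f : H) : ℝ :=
  (1 / √(n : ℝ)) * ∑ j ∈ Finset.range n,
    (Real.cos ⟪f, x j - sampleMean n x⟫ + Real.sin ⟪f, x j - sampleMean n x⟫
      - Real.exp (-(1 / 2) * ⟪sampleCov n x f, f⟫))

/-- `V_n^⋆ = V_n / √n`. -/
def VnStar (n : ℕ) (x : ℕ → H) (f : H) : ℝ :=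
  Vn n x f / √(n : ℝ)

end Sample

section Population

variable {Ω : Type*} [MeasurableSpace Ω]
  {H : Type*} [NormedAddCommGroup H] [InnerProductSpace ℝ H]

/-- The covariance operator `f ↦ E(⟨X - E X, f⟩ X)` of the random element `X`. -/
def covOp (P : Measure Ω) (X : Ω → H) (f : H) : H :=
  ∫ ω, ⟪X ω - ∫ ω', X ω' ∂P, f⟫ • X ω ∂P

/-- `σ_f² = ⟨C f, f⟩`, with `C` the covariance operator of `X`. -/
def sigmaSq (P : Measure Ω) (X : Ω → H) (f : H) : ℝ :=
  ⟪covOp P X f, f⟫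

/-- `z(f) = E cos⟨f, X⟩ + E sin⟨f, X⟩ - exp(-σ_f² / 2)`. -/
def zFun (P : Measure Ω) (X : Ω → H) (f : H) : ℝ :=
  (∫ ω, Real.cos ⟪f, X ω⟫ ∂P) + (∫ ω, Real.sin ⟪f, X ω⟫ ∂P)
    - Real.exp (-(1 / 2) * sigmaSq P X f)

/-- The linearization `ξ(f, x)`. -/
def xiFun (P : Measure Ω) (X : Ω → H) (f x : H) : ℝ :=
  Real.cos ⟪f, x⟫ - (∫ ω, Real.cos ⟪f, X ω⟫ ∂P)
    + Real.sin ⟪f, x⟫ - (∫ ω, Real.sin ⟪f, X ω⟫ ∂P)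
    + ⟪f, x⟫ * (∫ ω, (Real.sin ⟪f, X ω⟫ - Real.cos ⟪f, X ω⟫) ∂P)
    + (1 / 2) * Real.exp (-(1 / 2) * sigmaSq P X f) * (⟪f, x⟫ ^ 2 - sigmaSq P X f)

/-- The kernel `K^⋆(f, g) = E[ξ(f, X) ξ(g, X)]`. -/
def kernelStar (P : Measure Ω) (X : Ω → H) (f g : H) : ℝ :=
  ∫ ω, xiFun P X f (X ω) * xiFun P X g (X ω) ∂P

end Population

/-- `V` is a centred Gaussian random element of `L²_Q` with covariance kernel `K`. Members of
`L²_Q` are classes of functions, so that the kernel is read through the covariance operator: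
`E[⟨V, Φ⟩ ⟨V, Ψ⟩] = ∬ K(f, g) Φ(f) Ψ(g) Q(df) Q(dg)` for all `Φ`, `Ψ` in `L²_Q`. -/
structure IsCentredGaussianWithKernel {H : Type*} [MeasurableSpace H] (Q : Measure H)
    {Ω : Type*} [MeasurableSpace Ω] (P : Measure Ω) (V : Ω → L2Q Q) (K : H → H → ℝ) : Prop where
  gaussian : HasGaussianLaw V P
  centred : ∫ ω, V ω ∂P = 0
  integrable_inner : ∀ Φ Ψ : L2Q Q, Integrable (fun ω => ⟪V ω, Φ⟫ * ⟪V ω, Ψ⟫) P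
  integrable_kernel : ∀ Φ Ψ : L2Q Q,
    Integrable (fun p : H × H => K p.1 p.2 * Φ p.1 * Ψ p.2) (Q.prod Q)
  covariance : ∀ Φ Ψ : L2Q Q,
    ∫ ω, ⟪V ω, Φ⟫ * ⟪V ω, Ψ⟫ ∂P = ∫ p : H × H, K p.1 p.2 * Φ p.1 * Ψ p.2 ∂(Q.prod Q)

end

set_option linter.unusedSectionVars false

/-! The statistic does not change when a constant is subtracted from the data, so the sample may be
taken centred. Write `b = ⟪f, mean⟫` and let `C`, `S`, `w` be the empirical means of `cos⟪f, Y_j⟫`,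
`sin⟪f, Y_j⟫` and `⟪f, Y_j⟫ ^ 2`. The addition formulas give `V_n^⋆(f) = cos b (C + S) + sin b (S -
C) - exp(-(w - b²)/2)`. Expanding to first order in `b` and `w - σ_f²` yields `z(f)` plus the
average of `ξ(f, Y_j)`: estimating the mean produces the term of `ξ` linear in `x`, estimating the
covariance the quadratic one. The error is bounded pointwise in `abs_linearization_error_le`.

The leading term is a normalized sum of i.i.d. centred elements `ξ(·, Y_j)` of `L²_Q`. Since `|ξ(f,
x)|` is at most a constant times `(1 + ‖f‖²)(1 + ‖x‖²)` (`abs_xiFun_le`), the fourth moments of `Q`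
and of `Y` give it a finite second moment. The Hilbert space central limit theorem
`exists_isGaussian_tendstoInDistribution_normSum` then supplies a Gaussian limit, and Fubini
identifies its covariance with the kernel `K^⋆`. That theorem comes from tightness, one-dimensional
limits of characteristic functions, and Prokhorov's theorem.

The error is `√n` times three terms, each a product of two small factors: `b²`, `b (S - C - D)` with
`D = E(sin - cos)`, and `|w - σ²| min(1, |w - σ²|)`. The root `n` turns one factor into a normalized
sum bounded in `L²`, while the other tends to zero in probability (`tendstoZeroInProb_normSum_mul`).
In the last product, symmetric tensors make `w - σ_f²` linear in an average of Hilbert-valued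
variables, and the minimum keeps the growth in `f` at `‖f‖²`, so fourth moments of `Q` suffice.
Slutsky's lemma concludes. -/

noncomputable section

/-! ### Second moments of i.i.d. sums, and compactness in Hilbert space -/

section HilbertCLT

open scoped Topology ENNReal

variable {Ω : Type*} [MeasurableSpace Ω] {P : Measure Ω} [IsProbabilityMeasure P]
  {E : Type*} [NormedAddCommGroup E] [InnerProductSpace ℝ E] [CompleteSpace E]
  [MeasurableSpace E] [BorelSpace E]

theorem MeasureTheory.MemLp.integrable_inner {f g : Ω → E} (hf : MemLp f 2 P)
    (hg : MemLp g 2 P) : Integrable (fun ω => ⟪f ω, g ω⟫) P :=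
  (hf.norm.integrable_mul hg.norm).mono' (hf.1.inner hg.1)
    (.of_forall fun ω => by simpa using abs_real_inner_le_norm (f ω) (g ω))

/-- The variance of a sum of independent, identically distributed, centred random vectors. -/
theorem integral_norm_sum_sq {ζ : ℕ → Ω → E} {ζ₀ : Ω → E} (hindep : iIndepFun ζ P)
    (hident : ∀ j, IdentDistrib (ζ j) ζ₀ P P) (h2 : MemLp ζ₀ 2 P) (h0 : ∫ ω, ζ₀ ω ∂P = 0) (n : ℕ) :
    ∫ ω, ‖∑ j ∈ Finset.range n, ζ j ω‖ ^ 2 ∂P = n * ∫ ω, ‖ζ₀ ω‖ ^ 2 ∂P := by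
  have hm : ∀ j, MemLp (ζ j) 2 P := fun j => (hident j).memLp_iff.2 h2
  have hi : ∀ i j, Integrable (fun ω => ⟪ζ i ω, ζ j ω⟫) P := fun i j => (hm i).integrable_inner (hm j)
  have hz : ∀ i j, i ≠ j → ∫ ω, ⟪ζ i ω, ζ j ω⟫ ∂P = 0 := by
    intro i j hij
    have := (hindep.indepFun hij).integral_bilin ((hm i).integrable one_le_two)
      ((hm j).integrable one_le_two) (innerSL ℝ)
    rw [(hident i).integral_eq, h0, map_zero] at this
    exact this
  have hd : ∀ i, ∫ ω, ⟪ζ i ω, ζ i ω⟫ ∂P = ∫ ω, ‖ζ₀ ω‖ ^ 2 ∂P := by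
    intro i
    simp_rw [real_inner_self_eq_norm_sq]
    exact ((hident i).comp (u := fun x => ‖x‖ ^ 2) (by fun_prop)).integral_eq
  simp_rw [← real_inner_self_eq_norm_sq (∑ j ∈ Finset.range n, ζ j _), sum_inner, inner_sum]
  rw [integral_finsetSum _ fun i _ => integrable_finsetSum _ fun j _ => hi i j]
  have : ∀ i ∈ Finset.range n, ∫ ω, ∑ j ∈ Finset.range n, ⟪ζ i ω, ζ j ω⟫ ∂P
      = ∫ ω, ‖ζ₀ ω‖ ^ 2 ∂P := by
    intro i hin
    rw [integral_finsetSum _ fun j _ => hi i j, Finset.sum_eq_single_of_mem i hin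
      (fun j _ hj => hz i j hj.symm), hd]
  rw [Finset.sum_congr rfl this]
  simp

theorem lintegral_enorm_sq_eq_ofReal {f : Ω → E} (hf : MemLp f 2 P) :
    ∫⁻ ω, ‖f ω‖ₑ ^ 2 ∂P = ENNReal.ofReal (∫ ω, ‖f ω‖ ^ 2 ∂P) := by
  rw [ofReal_integral_eq_lintegral_ofReal (by simpa using hf.norm.integrable_sq)
    (.of_forall fun ω => by positivity)]
  simp [ENNReal.ofReal_pow]

/-- Normalized sums of independent, identically distributed, centred random vectors. -/
def normSum (ζ : ℕ → Ω → E) (n : ℕ) (ω : Ω) : E :=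
  (√(n : ℝ))⁻¹ • ∑ j ∈ Finset.range n, ζ j ω

/-- Orthogonality of the summands makes this an equality for `n ≠ 0`; at `n = 0` the left side
vanishes. Separability is not assumed, so the bound also serves the tensor-square space below. -/
theorem lintegral_enorm_normSum_sq_le {ζ : ℕ → Ω → E} {ζ₀ : Ω → E} (hindep : iIndepFun ζ P)
    (hident : ∀ j, IdentDistrib (ζ j) ζ₀ P P) (h2 : MemLp ζ₀ 2 P) (h0 : ∫ ω, ζ₀ ω ∂P = 0) (n : ℕ) :
    ∫⁻ ω, ‖normSum ζ n ω‖ₑ ^ 2 ∂P ≤ ∫⁻ ω, ‖ζ₀ ω‖ₑ ^ 2 ∂P := by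
  have hm : ∀ j, MemLp (ζ j) 2 P := fun j => (hident j).memLp_iff.2 h2
  have hs : MemLp (normSum ζ n) 2 P := (memLp_finsetSum _ fun j _ => hm j).const_smul _
  rw [lintegral_enorm_sq_eq_ofReal hs, lintegral_enorm_sq_eq_ofReal h2]
  refine ENNReal.ofReal_le_ofReal ?_
  have : ∀ ω, ‖normSum ζ n ω‖ ^ 2 = (n : ℝ)⁻¹ * ‖∑ j ∈ Finset.range n, ζ j ω‖ ^ 2 := by
    intro ω
    rw [normSum, norm_smul, mul_pow, norm_inv, inv_pow, Real.norm_eq_abs, sq_abs,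
      Real.sq_sqrt (by positivity)]
  simp_rw [this]
  rw [integral_const_mul, integral_norm_sum_sq hindep hident h2 h0, ← mul_assoc]
  refine mul_le_of_le_one_left (integral_nonneg fun ω => by positivity) ?_
  exact inv_mul_le_one

variable [SecondCountableTopology E]

/-- An increasing sequence of finite-dimensional subspaces with dense union. -/
theorem exists_finiteDimensional_tendsto_starProjection (E : Type*) [NormedAddCommGroup E]
    [InnerProductSpace ℝ E] [SecondCountableTopology E] :
    ∃ U : ℕ → Submodule ℝ E, ∃ _ : ∀ k, FiniteDimensional ℝ (U k),
      ∀ x, Tendsto (fun k => (U k).starProjection x) atTop (𝓝 x) := by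
  let U : ℕ → Submodule ℝ E := fun k =>
    Submodule.span ℝ (TopologicalSpace.denseSeq E '' (Set.Iio k))
  have hf : ∀ k, FiniteDimensional ℝ (U k) := fun k =>
    FiniteDimensional.span_of_finite ℝ ((Set.finite_Iio k).image _)
  refine ⟨U, hf, fun x => Submodule.starProjection_tendsto_self U ?_ x ?_⟩
  · intro i j hij
    exact Submodule.span_mono (Set.image_mono (Set.Iio_subset_Iio hij))
  · intro y _
    have : Set.range (TopologicalSpace.denseSeq E) ⊆ (⨆ k, U k : Submodule ℝ E) := by
      rintro _ ⟨k, rfl⟩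
      exact (le_iSup U (k + 1)) (Submodule.subset_span ⟨k, by simp, rfl⟩)
    exact closure_mono this (TopologicalSpace.denseRange_denseSeq E y)

/-- Dominated convergence: the residual tends to zero pointwise and its norm never exceeds that of
the vector itself. -/
theorem tendsto_lintegral_sub_starProjection {ζ₀ : Ω → E} (h2 : MemLp ζ₀ 2 P)
    {U : ℕ → Submodule ℝ E} [∀ k, FiniteDimensional ℝ (U k)]
    (hU : ∀ x, Tendsto (fun k => (U k).starProjection x) atTop (𝓝 x)) :
    Tendsto (fun k => ∫⁻ ω, ‖ζ₀ ω - (U k).starProjection (ζ₀ ω)‖ₑ ^ 2 ∂P) atTop (𝓝 0) := by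
  have hfin : ∫⁻ ω, ‖ζ₀ ω‖ₑ ^ 2 ∂P ≠ ∞ := by
    rw [lintegral_enorm_sq_eq_ofReal h2]; exact ENNReal.ofReal_ne_top
  have := tendsto_lintegral_of_dominated_convergence' (μ := P)
    (F := fun k ω => ‖ζ₀ ω - (U k).starProjection (ζ₀ ω)‖ₑ ^ 2) (f := fun _ => 0)
    (fun ω => ‖ζ₀ ω‖ₑ ^ 2) (fun k => ?_) (fun k => .of_forall fun ω => ?_) hfin
    (.of_forall fun ω => ?_)
  · simpa using this
  · exact (h2.1.sub ((U k).starProjection.continuous.comp_aestronglyMeasurable h2.1)).enorm.pow_const 2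
  · refine pow_le_pow_left' ?_ 2
    rw [← Submodule.starProjection_orthogonal_val, ← ofReal_norm, ← ofReal_norm]
    exact ENNReal.ofReal_le_ofReal (Submodule.norm_starProjection_apply_le _ _)
  · have h : Tendsto (fun k => ‖ζ₀ ω - (U k).starProjection (ζ₀ ω)‖ₑ) atTop (𝓝 0) := by
      simpa using ((tendsto_const_nhds (x := ζ₀ ω)).sub (hU (ζ₀ ω))).enorm
    simpa using ENNReal.Tendsto.pow (n := 2) h

/-- Sets that are bounded and close to finite-dimensional subspaces are compact. -/
theorem isCompact_of_near_finiteDimensional {U : ℕ → Submodule ℝ E}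
    [∀ k, FiniteDimensional ℝ (U k)] {δ : ℕ → ℝ} (hδ : Tendsto δ atTop (𝓝 0)) (R : ℝ) :
    IsCompact {x : E | ‖x‖ ≤ R ∧ ∀ k, ‖x - (U k).starProjection x‖ ≤ δ k} := by
  have hcl : IsClosed {x : E | ‖x‖ ≤ R ∧ ∀ k, ‖x - (U k).starProjection x‖ ≤ δ k} := by
    refine (isClosed_le (f := fun x : E => ‖x‖) (by fun_prop) (by fun_prop)).inter ?_
    have : {x : E | ∀ k, ‖x - (U k).starProjection x‖ ≤ δ k}
        = ⋂ k, {x : E | ‖x - (U k).starProjection x‖ ≤ δ k} := by ext; simp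
    change IsClosed {x : E | ∀ k, ‖x - (U k).starProjection x‖ ≤ δ k}
    rw [this]
    exact isClosed_iInter fun k =>
      isClosed_le (f := fun x : E => ‖x - (U k).starProjection x‖) (by fun_prop) (by fun_prop)
  refine TotallyBounded.isCompact_of_isClosed ?_ hcl
  rw [Metric.totallyBounded_iff]
  intro ε hε
  -- One subspace at distance less than `ε / 2` is enough: the projected set lies in a compact ball
  -- there, and a finite `ε / 2`-net of that ball is an `ε`-net of the whole set.
  obtain ⟨k, hk⟩ := (hδ.eventually (gt_mem_nhds (half_pos hε))).exists
  have hc : IsCompact ((↑) '' (Metric.closedBall (0 : U k) R) : Set E) :=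
    (isCompact_closedBall _ _).image continuous_subtype_val
  obtain ⟨t, ht, hsub⟩ := Metric.totallyBounded_iff.1 hc.totallyBounded (ε / 2) (half_pos hε)
  refine ⟨t, ht, fun x hx => ?_⟩
  have hmem : (U k).starProjection x ∈ ((↑) '' (Metric.closedBall (0 : U k) R) : Set E) := by
    refine ⟨⟨(U k).starProjection x, (U k).starProjection_apply_mem x⟩, ?_, rfl⟩
    simpa using ((U k).norm_starProjection_apply_le x).trans hx.1
  obtain ⟨y, hy, hxy⟩ := Set.mem_iUnion₂.1 (hsub hmem)
  refine Set.mem_iUnion₂.2 ⟨y, hy, ?_⟩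
  rw [Metric.mem_ball] at hxy ⊢
  calc dist x y ≤ dist x ((U k).starProjection x) + dist ((U k).starProjection x) y :=
        dist_triangle _ _ _
    _ < ε / 2 + ε / 2 := by
        refine add_lt_add_of_le_of_lt ?_ hxy
        rw [dist_eq_norm]
        exact (hx.2 k).trans hk.le
    _ = ε := add_halves ε

end HilbertCLT

/-! ### The central limit theorem in a separable Hilbert space -/

section HilbertCLTLimit

open scoped Topology ENNReal

variable {Ω : Type*} [MeasurableSpace Ω] {P : Measure Ω} [IsProbabilityMeasure P]
  {E : Type*} [NormedAddCommGroup E] [InnerProductSpace ℝ E] [CompleteSpace E]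
  [MeasurableSpace E] [BorelSpace E] [SecondCountableTopology E]
  {ζ : ℕ → Ω → E} {ζ₀ : Ω → E}

theorem aemeasurable_normSum (hident : ∀ j, IdentDistrib (ζ j) ζ₀ P P) (n : ℕ) :
    AEMeasurable (normSum ζ n) P :=
  (Finset.aemeasurable_fun_sum _ fun j _ => (hident j).aemeasurable_fst).const_smul _

theorem measure_lt_norm_le (f : Ω → E) (hf : AEMeasurable f P) {r : ℝ} (hr : 0 < r) :
    P {ω | r < ‖f ω‖} ≤ (∫⁻ ω, ‖f ω‖ₑ ^ 2 ∂P) / ENNReal.ofReal r ^ 2 := by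
  refine (measure_mono fun ω hω => ?_).trans
    (meas_ge_le_lintegral_div (hf.enorm.pow_const 2) (by simpa using hr) (by finiteness))
  rw [Set.mem_ofPred_eq, ← ofReal_norm]
  exact pow_le_pow_left' (ENNReal.ofReal_le_ofReal (le_of_lt hω)) 2

/-- The residual of a normalized sum off a finite-dimensional subspace is the normalized sum of the
residuals, so its second moment is bounded by that of a single residual, uniformly in `n`.
Chebyshev's inequality then gives one compact set for all `n`. -/
theorem isTightMeasureSet_normSum (hindep : iIndepFun ζ P)
    (hident : ∀ j, IdentDistrib (ζ j) ζ₀ P P) (h2 : MemLp ζ₀ 2 P) (h0 : ∫ ω, ζ₀ ω ∂P = 0) :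
    IsTightMeasureSet (Set.range fun n => P.map (normSum ζ n)) := by
  obtain ⟨U, hUf, hU⟩ := exists_finiteDimensional_tendsto_starProjection E
  have hlim := tendsto_lintegral_sub_starProjection h2 hU
  rw [isTightMeasureSet_iff_exists_isCompact_measure_compl_le]
  intro ε hε
  obtain ⟨ε', hε'pos, hε'⟩ := ENNReal.exists_pos_sum_of_countable (ι := ℕ)
    (ENNReal.half_pos hε.ne').ne' 
  let δ : ℕ → ℝ := fun k => (1 / 2) ^ k
  have hδpos : ∀ k, 0 < δ k := fun k => by positivity
  have hδ : Tendsto δ atTop (𝓝 0) := tendsto_pow_atTop_nhds_zero_of_lt_one (by norm_num) (by norm_num)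
  have hM : ∫⁻ ω, ‖ζ₀ ω‖ₑ ^ 2 ∂P ≠ ∞ := by
    rw [lintegral_enorm_sq_eq_ofReal h2]; exact ENNReal.ofReal_ne_top
  have hk : ∀ k, ∃ i, (∫⁻ ω, ‖ζ₀ ω - (U i).starProjection (ζ₀ ω)‖ₑ ^ 2 ∂P)
      / ENNReal.ofReal (δ k) ^ 2 ≤ ε' k := by
    intro k
    have h : Tendsto (fun i => (∫⁻ ω, ‖ζ₀ ω - (U i).starProjection (ζ₀ ω)‖ₑ ^ 2 ∂P)
        / ENNReal.ofReal (δ k) ^ 2) atTop (𝓝 0) := by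
      have := ENNReal.Tendsto.div_const hlim (b := ENNReal.ofReal (δ k) ^ 2)
        (.inr (by simpa using hδpos k))
      simpa using this
    exact (h.eventually (Iic_mem_nhds (by simpa using hε'pos k))).exists
  -- The subspace with index `i k` captures so much of the variance that a residual above `2⁻ᵏ` has
  -- probability at most `ε' k`; these sum to less than `ε / 2`, and the other half pays for the
  -- norm bound `R`.
  choose i hi using hk
  have hR : ∃ R : ℝ, 0 < R ∧ (∫⁻ ω, ‖ζ₀ ω‖ₑ ^ 2 ∂P) / ENNReal.ofReal R ^ 2 ≤ ε / 2 := by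
    have h1 : Tendsto (fun R : ℝ => ENNReal.ofReal R ^ 2) atTop (𝓝 ∞) := by
      have := ENNReal.Tendsto.pow (n := 2) ENNReal.tendsto_ofReal_atTop
      simpa using this
    have h2 : Tendsto (fun R : ℝ => (∫⁻ ω, ‖ζ₀ ω‖ₑ ^ 2 ∂P) / ENNReal.ofReal R ^ 2) atTop (𝓝 0) := by
      have := ENNReal.Tendsto.const_div h1 (.inr hM)
      simpa using this
    exact ((eventually_gt_atTop 0).and
      (h2.eventually (Iic_mem_nhds (ENNReal.half_pos hε.ne')))).exists
  obtain ⟨R, hRpos, hRle⟩ := hR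
  refine ⟨_, isCompact_of_near_finiteDimensional (U := fun k => U (i k)) hδ R, ?_⟩
  rintro _ ⟨n, rfl⟩
  have hmeas := aemeasurable_normSum hident n
  have hcl := (isCompact_of_near_finiteDimensional (U := fun k => U (i k)) hδ R).isClosed
  rw [Measure.map_apply_of_aemeasurable hmeas hcl.measurableSet.compl]
  have hproj : ∀ k, P {ω | δ k < ‖normSum ζ n ω - (U (i k)).starProjection (normSum ζ n ω)‖}
      ≤ ε' k := by
    intro k
    let L : E →L[ℝ] E := ContinuousLinearMap.id ℝ E - (U (i k)).starProjection
    have hL : ∀ ω, normSum ζ n ω - (U (i k)).starProjection (normSum ζ n ω)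
        = normSum (fun j ω => L (ζ j ω)) n ω := by
      intro ω
      change L (normSum ζ n ω) = _
      simp [normSum]
    have hLint : ∫ ω, L (ζ₀ ω) ∂P = 0 := by
      rw [L.integral_comp_comm (h2.integrable one_le_two), h0, map_zero]
    have hLident : ∀ j, IdentDistrib (fun ω => L (ζ j ω)) (fun ω => L (ζ₀ ω)) P P := fun j =>
      (hident j).comp L.measurable
    simp_rw [hL]
    refine (measure_lt_norm_le _ (aemeasurable_normSum hLident n) (hδpos k)).trans
      (le_trans (ENNReal.div_le_div_right ?_ _) (hi k))
    exact lintegral_enorm_normSum_sq_le (hindep.comp (fun _ => L) fun _ => L.measurable) hLident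
      (L.comp_memLp' h2) hLint n
  have hbig : P {ω | R < ‖normSum ζ n ω‖} ≤ ε / 2 := by
    refine (measure_lt_norm_le _ hmeas hRpos).trans (le_trans (ENNReal.div_le_div_right ?_ _) hRle)
    exact lintegral_enorm_normSum_sq_le hindep hident h2 h0 n
  calc _ ≤ P ({ω | R < ‖normSum ζ n ω‖}
          ∪ ⋃ k, {ω | δ k < ‖normSum ζ n ω - (U (i k)).starProjection (normSum ζ n ω)‖}) := by
        refine measure_mono fun ω hω => ?_
        by_contra hcon
        refine hω ?_
        simp only [Set.mem_union, Set.mem_iUnion, Set.mem_ofPred_eq, not_or, not_exists,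
          not_lt] at hcon
        exact hcon
    _ ≤ ε / 2 + ∑' k, (ε' k : ℝ≥0∞) :=
        (measure_union_le _ _).trans
          (add_le_add hbig ((measure_iUnion_le _).trans (ENNReal.tsum_le_tsum hproj)))
    _ ≤ ε / 2 + ε / 2 := by gcongr
    _ = ε := ENNReal.add_halves ε

/-- Cramér–Wold: testing against `t` reduces to the real central limit theorem for `⟪ζ j, t⟫`, with
its characteristic function read at `1`. -/
theorem tendsto_charFun_map_normSum (hindep : iIndepFun ζ P)
    (hident : ∀ j, IdentDistrib (ζ j) ζ₀ P P) (h2 : MemLp ζ₀ 2 P) (h0 : ∫ ω, ζ₀ ω ∂P = 0) (t : E) :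
    Tendsto (fun n => charFun (P.map (normSum ζ n)) t) atTop
      (𝓝 (charFun (gaussianReal 0 (∫ ω, ⟪ζ₀ ω, t⟫ ^ 2 ∂P).toNNReal) 1)) := by
  have hid : ∀ j, IdentDistrib (fun ω => ⟪ζ j ω, t⟫) (fun ω => ⟪ζ₀ ω, t⟫) P P := fun j =>
    (hident j).comp (u := fun x => ⟪x, t⟫) (by fun_prop)
  have hmean : ∫ ω, ⟪ζ 0 ω, t⟫ ∂P = 0 := by
    rw [(hid 0).integral_eq]
    simp_rw [real_inner_comm]
    rw [integral_inner (h2.integrable one_le_two), h0, inner_zero_right]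
  have hvar : Var[fun ω => ⟪ζ 0 ω, t⟫; P] = ∫ ω, ⟪ζ₀ ω, t⟫ ^ 2 ∂P := by
    rw [variance_of_integral_eq_zero (hid 0).aemeasurable_fst hmean]
    exact ((hid 0).comp (u := fun x => x ^ 2) (by fun_prop)).integral_eq
  have hclt := tendstoInDistribution_inv_sqrt_mul_sum_sub (P := P)
    (X := fun j ω => ⟪ζ j ω, t⟫) (Y := id)
    (P' := gaussianReal 0 (Var[fun ω => ⟪ζ 0 ω, t⟫; P]).toNNReal) .id
    (((hident 0).memLp_iff.2 h2).inner_const t)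
    (hindep.comp (fun _ x => ⟪x, t⟫) fun _ => by fun_prop)
    (fun j => (hid j).trans (hid 0).symm)
  have := ProbabilityMeasure.tendsto_iff_tendsto_charFun.1 hclt.tendsto 1
  simp only [ProbabilityMeasure.coe_mk, Measure.map_id, hvar] at this
  refine this.congr fun n => ?_
  rw [charFun_apply, charFun_apply, integral_map (hclt.forall_aemeasurable n) (by fun_prop),
    integral_map (aemeasurable_normSum hident n) (by fun_prop)]
  congr 1
  ext ω
  simp [normSum, inner_smul_left, sum_inner, hmean]

/-- The central limit theorem in a separable Hilbert space. -/
theorem exists_isGaussian_tendstoInDistribution_normSum (hindep : iIndepFun ζ P)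
    (hident : ∀ j, IdentDistrib (ζ j) ζ₀ P P) (h2 : MemLp ζ₀ 2 P) (h0 : ∫ ω, ζ₀ ω ∂P = 0) :
    ∃ (μ : Measure E) (_ : IsProbabilityMeasure μ), IsGaussian μ ∧ ∫ x, x ∂μ = 0 ∧
      (∀ s t, ∫ x, ⟪x, s⟫ * ⟪x, t⟫ ∂μ = ∫ ω, ⟪ζ₀ ω, s⟫ * ⟪ζ₀ ω, t⟫ ∂P) ∧
      TendstoInDistribution (normSum ζ) atTop id (fun _ => P) μ := by
  have hmeas := aemeasurable_normSum hident
  let ν : ℕ → ProbabilityMeasure E := fun n =>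
    ⟨P.map (normSum ζ n), Measure.isProbabilityMeasure_map (hmeas n)⟩
  have hcomp : IsCompact (closure (Set.range ν)) := by
    refine isCompact_closure_of_isTightMeasureSet ?_
    refine (isTightMeasureSet_normSum hindep hident h2 h0).subset ?_
    rintro _ ⟨_, ⟨n, rfl⟩, rfl⟩
    exact ⟨n, rfl⟩
  have hcont : ∀ t : E, Continuous fun μ : ProbabilityMeasure E => charFun (μ : Measure E) t := by
    intro t
    simp_rw [charFun_eq_integral_innerProbChar]
    refine continuous_iff_continuousAt.2 fun μ => ?_
    exact (ProbabilityMeasure.tendsto_iff_forall_integral_rclike_tendsto ℂ).1 tendsto_id _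
  -- Evaluating the characteristic function at `t` is weakly continuous, so every cluster point
  -- inherits the limit along the full sequence. This determines the cluster point, and compactness
  -- turns uniqueness into convergence.
  have hcluster : ∀ μ : ProbabilityMeasure E, MapClusterPt μ atTop ν → ∀ t,
      charFun (μ : Measure E) t
        = charFun (gaussianReal 0 (∫ ω, ⟪ζ₀ ω, t⟫ ^ 2 ∂P).toNNReal) 1 := by
    intro μ hμ t
    have h1 := hμ.tendsto_comp ((hcont t).tendsto μ)
    exact eq_of_nhds_neBot
      (ClusterPt.mono h1 (tendsto_charFun_map_normSum hindep hident h2 h0 t))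
  have hmem : ∀ᶠ n in atTop, ν n ∈ closure (Set.range ν) :=
    Eventually.of_forall fun n => subset_closure ⟨n, rfl⟩
  obtain ⟨μ, -, hμ⟩ := hcomp.exists_mapClusterPt (u := ν) (f := atTop) (tendsto_principal.2 hmem)
  have hμc := hcluster μ hμ
  have htend : Tendsto ν atTop (𝓝 μ) := by
    refine hcomp.tendsto_nhds_of_unique_mapClusterPt hmem fun μ' _ hμ' => ?_
    have h : (μ' : Measure E) = μ := Measure.ext_of_charFun
      (funext fun t => (hcluster μ' hμ' t).trans (hμc t).symm)
    exact Subtype.ext h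
  -- The characteristic function of the marginal along `t` at `u` is that of the limit at `u • t`,
  -- and the variance is quadratic in `t`.
  have hmap : ∀ t : E, (μ : Measure E).map (fun x => ⟪x, t⟫)
      = gaussianReal 0 (∫ ω, ⟪ζ₀ ω, t⟫ ^ 2 ∂P).toNNReal := by
    intro t
    refine Measure.ext_of_charFun ?_
    ext u
    have h1 : charFun ((μ : Measure E).map (fun x => ⟪x, t⟫)) u = charFun (μ : Measure E) (u • t) := by
      rw [charFun_apply, charFun_apply, integral_map (by fun_prop) (by fun_prop)]
      simp [inner_smul_right]
    have h2 : ∫ ω, ⟪ζ₀ ω, u • t⟫ ^ 2 ∂P = u ^ 2 * ∫ ω, ⟪ζ₀ ω, t⟫ ^ 2 ∂P := by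
      simp_rw [inner_smul_right, mul_pow]
      exact integral_const_mul _ _
    have h3 : 0 ≤ ∫ ω, ⟪ζ₀ ω, t⟫ ^ 2 ∂P := integral_nonneg fun ω => by positivity
    rw [h1, hμc, h2, charFun_gaussianReal, charFun_gaussianReal,
      Real.coe_toNNReal _ h3, Real.coe_toNNReal _ (by positivity)]
    push_cast
    ring_nf
  have hgauss : IsGaussian (μ : Measure E) := by
    refine isGaussian_of_map_eq_gaussianReal fun L => ?_
    refine ⟨0, (∫ ω, ⟪ζ₀ ω, (InnerProductSpace.toDual ℝ E).symm L⟫ ^ 2 ∂P).toNNReal, ?_⟩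
    rw [← hmap]
    congr 1
    ext x
    rw [real_inner_comm, InnerProductSpace.toDual_symm_apply]
  have hL2 : MemLp (id : E → E) 2 (μ : Measure E) := IsGaussian.memLp_id _ 2 (by simp)
  have hmean : ∀ t : E, ∫ x, ⟪x, t⟫ ∂(μ : Measure E) = 0 := by
    intro t
    have : ∫ y, y ∂((μ : Measure E).map (fun x => ⟪x, t⟫)) = 0 := by
      rw [hmap, integral_id_gaussianReal]
    rwa [integral_map (by fun_prop) (by fun_prop)] at this
  have hsq : ∀ t : E, ∫ x, ⟪x, t⟫ ^ 2 ∂(μ : Measure E) = ∫ ω, ⟪ζ₀ ω, t⟫ ^ 2 ∂P := by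
    intro t
    have h3 : 0 ≤ ∫ ω, ⟪ζ₀ ω, t⟫ ^ 2 ∂P := integral_nonneg fun ω => by positivity
    have h4 : Var[fun x => ⟪x, t⟫; (μ : Measure E)] = ∫ ω, ⟪ζ₀ ω, t⟫ ^ 2 ∂P := by
      have := variance_id_gaussianReal (μ := 0) (v := (∫ ω, ⟪ζ₀ ω, t⟫ ^ 2 ∂P).toNNReal)
      rw [← hmap, variance_map (by fun_prop) (by fun_prop), Real.coe_toNNReal _ h3] at this
      exact this
    rw [← h4, variance_of_integral_eq_zero (by fun_prop) (hmean t)]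
  refine ⟨μ, inferInstance, hgauss, ?_, ?_, hmeas, by fun_prop, ?_⟩
  · refine ext_inner_left ℝ fun t => ?_
    have hi : Integrable (fun x : E => x) (μ : Measure E) := hL2.integrable one_le_two
    rw [inner_zero_right, ← integral_inner hi, ← hmean t]
    simp_rw [real_inner_comm t]
  · intro s t
    -- Polarization: only the variances along single directions are known from the marginals.
    have hpol : ∀ x : E, ⟪x, s⟫ * ⟪x, t⟫ = (⟪x, s + t⟫ ^ 2 - ⟪x, s - t⟫ ^ 2) / 4 := by
      intro x
      rw [inner_add_right, inner_sub_right]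
      ring
    simp_rw [hpol, integral_div]
    rw [integral_sub, integral_sub, hsq, hsq]
    · exact (h2.inner_const _).integrable_sq
    · exact (h2.inner_const _).integrable_sq
    · exact (hL2.inner_const _).integrable_sq
    · exact (hL2.inner_const _).integrable_sq
  · simp only [Measure.map_id]
    exact htend

end HilbertCLTLimit

/-! ### Convergence to zero in probability -/

section ConvergenceInProbability

open scoped Topology ENNReal

variable {Ω : Type*} [MeasurableSpace Ω] {P : Measure Ω}

/-- Convergence to zero in probability of a sequence of extended nonnegative random variables. -/
def TendstoZeroInProb (P : Measure Ω) (A : ℕ → Ω → ℝ≥0∞) : Prop :=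
  ∀ ε, 0 < ε → Tendsto (fun n => P {ω | ε ≤ A n ω}) atTop (𝓝 0)

theorem TendstoZeroInProb.mono_ae {A B : ℕ → Ω → ℝ≥0∞} (hB : TendstoZeroInProb P B)
    (h : ∀ n, ∀ᵐ ω ∂P, A n ω ≤ B n ω) : TendstoZeroInProb P A := fun ε hε =>
  tendsto_of_tendsto_of_tendsto_of_le_of_le tendsto_const_nhds (hB ε hε) (fun _ => zero_le)
    fun n => measure_mono_ae ((h n).mono fun _ hω hle => le_trans hle hω)

theorem TendstoZeroInProb.add {A B : ℕ → Ω → ℝ≥0∞} (hA : TendstoZeroInProb P A)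
    (hB : TendstoZeroInProb P B) : TendstoZeroInProb P fun n ω => A n ω + B n ω := by
  intro ε hε
  have h := (hA (ε / 2) (ENNReal.half_pos hε.ne')).add (hB (ε / 2) (ENNReal.half_pos hε.ne'))
  rw [add_zero] at h
  refine tendsto_of_tendsto_of_tendsto_of_le_of_le tendsto_const_nhds h (fun _ => zero_le)
    fun n => (measure_mono fun ω hω => ?_).trans (measure_union_le _ _)
  by_contra hcon
  simp only [Set.mem_union, Set.mem_ofPred_eq, not_or, not_le] at hcon hω
  exact absurd hω (not_le.2 ((ENNReal.add_lt_add hcon.1 hcon.2).trans_eq (ENNReal.add_halves ε)))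

theorem measure_le_of_lintegral_sq {A : Ω → ℝ≥0∞} (hA : AEMeasurable A P) {ε : ℝ≥0∞}
    (h0 : ε ≠ 0) (htop : ε ≠ ∞) : P {ω | ε ≤ A ω} ≤ (∫⁻ ω, A ω ^ 2 ∂P) / ε ^ 2 :=
  (measure_mono (t := {ω | ε ^ 2 ≤ A ω ^ 2}) fun _ hω => pow_le_pow_left' hω 2).trans
    (meas_ge_le_lintegral_div (hA.pow_const 2) (by simpa using h0) (by finiteness))

theorem tendstoZeroInProb_of_lintegral_sq {A : ℕ → Ω → ℝ≥0∞} (hA : ∀ n, AEMeasurable (A n) P)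
    (h : Tendsto (fun n => ∫⁻ ω, A n ω ^ 2 ∂P) atTop (𝓝 0)) : TendstoZeroInProb P A := by
  intro ε hε
  -- The threshold may be `∞`, where Chebyshev's inequality says nothing; capping it at `1` only
  -- enlarges the event.
  have h1 : 0 < min ε 1 := lt_min hε one_pos
  have h2 : min ε 1 ≠ ∞ := (min_le_right ε 1).trans_lt ENNReal.one_lt_top |>.ne
  have h3 := ENNReal.Tendsto.div_const h (b := min ε 1 ^ 2) (.inr (pow_ne_zero 2 h1.ne'))
  rw [ENNReal.zero_div] at h3
  exact tendsto_of_tendsto_of_tendsto_of_le_of_le tendsto_const_nhds h3 (fun _ => zero_le)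
    fun n => (measure_mono fun ω hω => (min_le_left ε 1).trans hω).trans
      (measure_le_of_lintegral_sq (hA n) h1.ne' h2)

/-- The product of an `L²`-bounded sequence and one converging to zero in probability
converges to zero in probability. -/
theorem TendstoZeroInProb.mul_of_lintegral_sq_le {A B : ℕ → Ω → ℝ≥0∞}
    (hB : TendstoZeroInProb P B) (hA : ∀ n, AEMeasurable (A n) P) {M : ℝ≥0∞} (hM : M ≠ ∞)
    (h : ∀ n, ∫⁻ ω, A n ω ^ 2 ∂P ≤ M) : TendstoZeroInProb P fun n ω => A n ω * B n ω := by
  intro ε hε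
  rw [ENNReal.tendsto_nhds_zero]
  intro η hη
  -- If the product is at least `ε`, then `A ≥ K` or `B ≥ ε / K`. The level `K` makes the first
  -- event unlikely uniformly in `n`; the second becomes unlikely as `n` grows.
  have hK : ∃ K : ℝ, 0 < K ∧ M / ENNReal.ofReal K ^ 2 ≤ η / 2 := by
    have h1 : Tendsto (fun R : ℝ => ENNReal.ofReal R ^ 2) atTop (𝓝 ∞) := by
      simpa using ENNReal.Tendsto.pow (n := 2) ENNReal.tendsto_ofReal_atTop
    have h2 : Tendsto (fun R : ℝ => M / ENNReal.ofReal R ^ 2) atTop (𝓝 0) := by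
      simpa using ENNReal.Tendsto.const_div h1 (.inr hM)
    exact ((eventually_gt_atTop 0).and
      (h2.eventually (Iic_mem_nhds (ENNReal.half_pos hη.ne')))).exists
  obtain ⟨K, hK0, hK⟩ := hK
  have hK1 : ENNReal.ofReal K ≠ 0 := by simpa using hK0
  have hlim := hB (ε / ENNReal.ofReal K) (ENNReal.div_pos hε.ne' ENNReal.ofReal_ne_top)
  filter_upwards [hlim.eventually (Iic_mem_nhds (ENNReal.half_pos hη.ne'))] with n hn
  calc P {ω | ε ≤ A n ω * B n ω}
      ≤ P ({ω | ENNReal.ofReal K ≤ A n ω} ∪ {ω | ε / ENNReal.ofReal K ≤ B n ω}) := by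
        refine measure_mono fun ω hω => ?_
        by_contra hcon
        simp only [Set.mem_union, Set.mem_ofPred_eq, not_or, not_le] at hcon hω
        have := ENNReal.mul_lt_mul hcon.1 hcon.2
        rw [ENNReal.mul_div_cancel hK1 ENNReal.ofReal_ne_top] at this
        exact absurd hω (not_le.2 this)
    _ ≤ η / 2 + η / 2 := (measure_union_le _ _).trans (add_le_add
        (((measure_le_of_lintegral_sq (hA n) hK1 ENNReal.ofReal_ne_top).trans
          (ENNReal.div_le_div_right (h n) _)).trans hK) hn)
    _ = η := ENNReal.add_halves η

theorem TendstoZeroInProb.comp_tendsto {A : ℕ → Ω → ℝ≥0∞} (hA : TendstoZeroInProb P A)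
    {h : ℝ≥0∞ → ℝ≥0∞} (hh : Tendsto h (𝓝 0) (𝓝 0)) :
    TendstoZeroInProb P fun n ω => h (A n ω) := by
  intro ε hε
  obtain ⟨δ, hδ, hsub⟩ := ENNReal.nhds_zero_basis.mem_iff.1 (hh.eventually (gt_mem_nhds hε))
  refine tendsto_of_tendsto_of_tendsto_of_le_of_le tendsto_const_nhds (hA δ hδ)
    (fun _ => zero_le) fun n => measure_mono fun ω hω => ?_
  by_contra hcon
  have h2 : A n ω < δ := not_le.1 hcon
  have h1 : h (A n ω) < ε := hsub h2
  exact not_le.2 h1 hω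

end ConvergenceInProbability

/-! ### Measurability of maps into `L²_Q` -/

section MeasurabilityInLp

open scoped Topology ENNReal

/-- In a separable space every open set is a countable union of balls with centres in a dense
sequence and radii `1 / (m + 1)`. -/
theorem measurable_of_measurable_dist {S X : Type*} [MeasurableSpace S] [PseudoMetricSpace X]
    [TopologicalSpace.SeparableSpace X] [MeasurableSpace X] [BorelSpace X] {g : S → X}
    (h : ∀ c, Measurable fun s => dist (g s) c) : Measurable g := by
  refine measurable_of_isOpen fun U hU => ?_
  rcases isEmpty_or_nonempty X with hX | hX
  · rw [Set.eq_empty_of_isEmpty U]; exact MeasurableSet.empty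
  let d := TopologicalSpace.denseSeq X
  let I : Set (ℕ × ℕ) := {p | Metric.ball (d p.1) (1 / ((p.2 : ℝ) + 1)) ⊆ U}
  have hUeq : g ⁻¹' U = ⋃ p ∈ I, {s | dist (g s) (d p.1) < 1 / ((p.2 : ℝ) + 1)} := by
    ext s
    simp only [Set.mem_preimage, Set.mem_iUnion, Set.mem_ofPred_eq, exists_prop]
    constructor
    · intro hs
      obtain ⟨ε, hε, hball⟩ := Metric.isOpen_iff.1 hU _ hs
      obtain ⟨m, hm⟩ := exists_nat_one_div_lt (half_pos hε)
      obtain ⟨k, hk⟩ := (TopologicalSpace.denseRange_denseSeq X).exists_dist_lt (g s)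
        (ε := 1 / ((m : ℝ) + 1)) (by positivity)
      refine ⟨(k, m), fun x hx => hball ?_, hk⟩
      rw [Metric.mem_ball] at hx ⊢
      have h1 : dist (d k) (g s) < 1 / ((m : ℝ) + 1) := by rw [dist_comm]; exact hk
      have h2 := dist_triangle x (d k) (g s)
      dsimp only at hx
      linarith
    · rintro ⟨p, hp, hs⟩
      exact hp hs
  rw [hUeq]
  exact MeasurableSet.biUnion (Set.to_countable _) fun p _ =>
    measurableSet_lt (h _) measurable_const

variable {H : Type*} [MeasurableSpace H] {Q : Measure H} [SFinite Q]
  [TopologicalSpace.SeparableSpace (L2Q Q)]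

/-- The distance to a fixed class is a parametric integral, measurable in the parameter by Tonelli;
joint measurability of the integrand is thus all that is needed. -/
theorem measurable_toLp {S : Type*} [MeasurableSpace S] {F : S → H → ℝ}
    (hF : Measurable (Function.uncurry F)) (hL : ∀ s, MemLp (F s) 2 Q) :
    Measurable fun s => ((hL s).toLp (F s) : L2Q Q) := by
  refine measurable_of_measurable_dist fun c => ?_
  have heq : ∀ s, dist ((hL s).toLp (F s)) c
      = ((∫⁻ f, ‖F s f - c f‖ₑ ^ (2 : ℝ) ∂Q) ^ (1 / 2 : ℝ)).toReal := by
    intro s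
    rw [Lp.dist_def, eLpNorm_congr_ae (g := F s - ⇑c)
      ((hL s).coeFn_toLp.sub (ae_eq_refl _)),
      eLpNorm_eq_lintegral_rpow_enorm_toReal (by simp) (by simp)]
    simp
  simp_rw [heq]
  have hc : Measurable (c : H → ℝ) := (Lp.stronglyMeasurable c).measurable
  have : Measurable fun p : S × H => ‖F p.1 p.2 - c p.2‖ₑ ^ (2 : ℝ) :=
    ((hF.sub (hc.comp measurable_snd)).enorm).pow_const 2
  exact (this.lintegral_prod_right'.pow_const _).ennreal_toReal

end MeasurabilityInLp

/-! ### Moments, measurability and growth of `σ²`, `z` and `ξ` -/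

section Linearization

open scoped Topology ENNReal

variable {Ω : Type*} [MeasurableSpace Ω] {P : Measure Ω} [IsProbabilityMeasure P]
  {H : Type*} [NormedAddCommGroup H] [InnerProductSpace ℝ H] [CompleteSpace H]
  [SecondCountableTopology H] [MeasurableSpace H] [BorelSpace H] {Y : Ω → H}

theorem memLp_two_norm_sq {S : Type*} [MeasurableSpace S] {μ : Measure S}
    {Z : S → H} (hZ : AEMeasurable Z μ) (h4 : Integrable (fun s => ‖Z s‖ ^ 4) μ) :
    MemLp (fun s => ‖Z s‖ ^ 2) 2 μ := by
  rw [memLp_two_iff_integrable_sq (by fun_prop)]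
  refine h4.congr (.of_forall fun s => ?_)
  ring

theorem memLp_two_of_integrable_norm_pow_four {S : Type*} [MeasurableSpace S] {μ : Measure S}
    [IsFiniteMeasure μ] {Z : S → H} (hZ : AEMeasurable Z μ)
    (h4 : Integrable (fun s => ‖Z s‖ ^ 4) μ) : MemLp Z 2 μ := by
  rw [memLp_two_iff_integrable_sq_norm hZ.aestronglyMeasurable]
  exact (memLp_two_norm_sq hZ h4).integrable one_le_two

omit [CompleteSpace H] in
theorem integrable_cos_inner (hY : AEMeasurable Y P) (f : H) :
    Integrable (fun ω => Real.cos ⟪f, Y ω⟫) P :=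
  .of_bound (by fun_prop) 1 (.of_forall fun ω => Real.abs_cos_le_one _)

omit [CompleteSpace H] in
theorem integrable_sin_inner (hY : AEMeasurable Y P) (f : H) :
    Integrable (fun ω => Real.sin ⟪f, Y ω⟫) P :=
  .of_bound (by fun_prop) 1 (.of_forall fun ω => Real.abs_sin_le_one _)

theorem abs_integral_le_one {g : Ω → ℝ} (hg : ∀ ω, |g ω| ≤ 1) : |∫ ω, g ω ∂P| ≤ 1 := by
  simpa using norm_integral_le_of_norm_le_const (μ := P) (f := g) (C := 1) (.of_forall hg)

variable (hY : AEMeasurable Y P) (h2 : MemLp Y 2 P) (h0 : ∫ ω, Y ω ∂P = 0)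

include h2 h0 in
theorem sigmaSq_eq (f : H) : sigmaSq P Y f = ∫ ω, ⟪f, Y ω⟫ ^ 2 ∂P := by
  have hi : Integrable (fun ω => ⟪Y ω, f⟫ • Y ω) P := by
    refine (h2.norm.integrable_sq.const_mul ‖f‖).mono'
      ((h2.1.inner aestronglyMeasurable_const).smul h2.1) (.of_forall fun ω => ?_)
    rw [norm_smul]
    calc _ ≤ ‖Y ω‖ * ‖f‖ * ‖Y ω‖ := by gcongr; exact abs_real_inner_le_norm _ _
      _ = ‖f‖ * ‖Y ω‖ ^ 2 := by ring
  rw [sigmaSq, covOp, h0]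
  simp_rw [sub_zero]
  rw [real_inner_comm, ← integral_inner hi]
  congr 1
  ext ω
  rw [inner_smul_right, real_inner_comm, sq]

include h2 h0 in
theorem sigmaSq_nonneg (f : H) : 0 ≤ sigmaSq P Y f := by
  rw [sigmaSq_eq h2 h0]
  exact integral_nonneg fun ω => by positivity

include h2 h0 in
theorem sigmaSq_le (f : H) : sigmaSq P Y f ≤ ‖f‖ ^ 2 * ∫ ω, ‖Y ω‖ ^ 2 ∂P := by
  rw [sigmaSq_eq h2 h0, ← integral_const_mul]
  refine integral_mono_of_nonneg (.of_forall fun ω => by positivity)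
    (h2.norm.integrable_sq.const_mul _) (.of_forall fun ω => ?_)
  change ⟪f, Y ω⟫ ^ 2 ≤ ‖f‖ ^ 2 * ‖Y ω‖ ^ 2
  rw [← mul_pow, ← sq_abs]
  gcongr
  exact abs_real_inner_le_norm _ _

-- As `Y` is only almost everywhere measurable, the integral is first transported to the law of `Y`,
-- where the integrand is jointly measurable.
omit [IsProbabilityMeasure P] [CompleteSpace H] in
theorem measurable_integral_comp_inner [SFinite P] (hY : AEMeasurable Y P) {φ : ℝ → ℝ}
    (hφ : Measurable φ) : Measurable fun f => ∫ ω, φ ⟪f, Y ω⟫ ∂P := by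
  have h : ∀ f : H, ∫ ω, φ ⟪f, Y ω⟫ ∂P = ∫ y, φ ⟪f, y⟫ ∂(P.map Y) := fun f =>
    (integral_map hY (f := fun y => φ ⟪f, y⟫)
      (hφ.comp (by fun_prop : Measurable fun y : H => ⟪f, y⟫)).aestronglyMeasurable).symm
  simp_rw [h]
  have : Measurable fun p : H × H => φ ⟪p.1, p.2⟫ := hφ.comp (by fun_prop)
  exact this.stronglyMeasurable.integral_prod_right.measurable

include hY h2 h0 in
theorem measurable_sigmaSq : Measurable (sigmaSq P Y) := by
  have : sigmaSq P Y = fun f => ∫ ω, ⟪f, Y ω⟫ ^ 2 ∂P := funext (sigmaSq_eq h2 h0)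
  rw [this]
  exact measurable_integral_comp_inner hY (φ := fun x => x ^ 2) (by fun_prop)

include hY h2 h0 in
theorem measurable_zFun : Measurable (zFun P Y) := by
  have := measurable_sigmaSq hY h2 h0
  have h1 := measurable_integral_comp_inner hY Real.measurable_cos
  have h3 := measurable_integral_comp_inner hY Real.measurable_sin
  exact (h1.add h3).sub (Real.measurable_exp.comp (this.const_mul _))

include hY h2 h0 in
theorem measurable_xiFun : Measurable fun p : H × H => xiFun P Y p.1 p.2 := by
  have h1 := (measurable_integral_comp_inner hY Real.measurable_cos).comp
    (measurable_fst : Measurable (Prod.fst : H × H → H))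
  have h3 := (measurable_integral_comp_inner hY Real.measurable_sin).comp
    (measurable_fst : Measurable (Prod.fst : H × H → H))
  have h4 := (measurable_integral_comp_inner hY
    (Real.measurable_sin.sub Real.measurable_cos)).comp (measurable_fst : Measurable (Prod.fst : H × H → H))
  have h5 := (measurable_sigmaSq hY h2 h0).comp (measurable_fst : Measurable (Prod.fst : H × H → H))
  have h6 : Measurable fun p : H × H => ⟪p.1, p.2⟫ := by fun_prop
  exact (((((Real.measurable_cos.comp h6).sub h1).add (Real.measurable_sin.comp h6)).sub h3).add
    (h6.mul h4)).add (((Real.measurable_exp.comp (h5.const_mul _)).const_mul _).mul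
      ((h6.pow_const 2).sub h5))

-- The bound separates the variables: the factor in `f` is square integrable under `Q`, and the
-- factor in `x` under the law of `Y`, as soon as fourth moments exist. It serves every later
-- domination of `ξ`.
include h2 h0 in
theorem abs_xiFun_le (f x : H) : |xiFun P Y f x|
    ≤ (5 + ∫ ω, ‖Y ω‖ ^ 2 ∂P) * ((1 + ‖f‖ ^ 2) * (1 + ‖x‖ ^ 2)) := by
  have hc := Real.abs_cos_le_one ⟪f, x⟫
  have hs := Real.abs_sin_le_one ⟪f, x⟫
  have hC := abs_integral_le_one (P := P) (g := fun ω => Real.cos ⟪f, Y ω⟫)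
    fun ω => Real.abs_cos_le_one _
  have hS := abs_integral_le_one (P := P) (g := fun ω => Real.sin ⟪f, Y ω⟫)
    fun ω => Real.abs_sin_le_one _
  have hD : |∫ ω, (Real.sin ⟪f, Y ω⟫ - Real.cos ⟪f, Y ω⟫) ∂P| ≤ 2 := by
    have := norm_integral_le_of_norm_le_const (μ := P) (C := 2)
      (f := fun ω => Real.sin ⟪f, Y ω⟫ - Real.cos ⟪f, Y ω⟫) (.of_forall fun ω => ?_)
    · simpa using this
    · have h1 := Real.abs_sin_le_one ⟪f, Y ω⟫
      have h2 := Real.abs_cos_le_one ⟪f, Y ω⟫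
      exact (abs_sub _ _).trans (by linarith)
  have hb := abs_real_inner_le_norm f x
  have h5 := sigmaSq_nonneg h2 h0 f
  have h6 := sigmaSq_le h2 h0 f
  have he : Real.exp (-(1 / 2) * sigmaSq P Y f) ≤ 1 := Real.exp_le_one_iff.2 (by linarith)
  have he0 := Real.exp_pos (-(1 / 2) * sigmaSq P Y f)
  have hbsq : ⟪f, x⟫ ^ 2 ≤ ‖f‖ ^ 2 * ‖x‖ ^ 2 := by
    rw [← mul_pow, ← sq_abs]; gcongr
  have h7 : |⟪f, x⟫ * ∫ ω, (Real.sin ⟪f, Y ω⟫ - Real.cos ⟪f, Y ω⟫) ∂P| ≤ ‖f‖ * ‖x‖ * 2 := by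
    rw [abs_mul]; gcongr
  have h8 : |(1 / 2) * Real.exp (-(1 / 2) * sigmaSq P Y f) * (⟪f, x⟫ ^ 2 - sigmaSq P Y f)|
      ≤ 1 / 2 * 1 * (‖f‖ ^ 2 * ‖x‖ ^ 2 + ‖f‖ ^ 2 * ∫ ω, ‖Y ω‖ ^ 2 ∂P) := by
    rw [abs_mul, abs_mul, abs_of_pos he0, abs_of_pos (by norm_num : (0 : ℝ) < 1 / 2)]
    gcongr
    rw [abs_le]
    constructor <;> nlinarith [sq_nonneg ⟪f, x⟫, sq_nonneg (‖f‖ * ‖x‖)]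
  have hm : 0 ≤ ∫ ω, ‖Y ω‖ ^ 2 ∂P := integral_nonneg fun ω => by positivity
  set m := ∫ ω, ‖Y ω‖ ^ 2 ∂P
  have h9 : |xiFun P Y f x| ≤ 4 + ‖f‖ * ‖x‖ * 2
      + 1 / 2 * 1 * (‖f‖ ^ 2 * ‖x‖ ^ 2 + ‖f‖ ^ 2 * m) := by
    rw [xiFun]
    rw [abs_le] at hc hs hC hS h7 h8 ⊢
    constructor <;> linarith
  refine h9.trans ?_
  nlinarith [sq_nonneg (‖f‖ * ‖x‖ - 1), mul_nonneg hm (sq_nonneg (‖f‖ * ‖x‖)), sq_nonneg ‖f‖,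
    sq_nonneg ‖x‖, mul_nonneg hm (sq_nonneg ‖f‖), mul_nonneg hm (sq_nonneg ‖x‖),
    sq_nonneg (‖f‖ * ‖x‖), sq_nonneg (‖f‖ - ‖x‖)]

include hY h2 h0 in
theorem integral_xiFun_eq_zero (f : H) : ∫ ω, xiFun P Y f (Y ω) ∂P = 0 := by
  have hc := integrable_cos_inner hY f
  have hs := integrable_sin_inner hY f
  have hi : Integrable (fun ω => ⟪f, Y ω⟫) P := (h2.const_inner f).integrable one_le_two
  have hsq : Integrable (fun ω => ⟪f, Y ω⟫ ^ 2) P := (h2.const_inner f).integrable_sq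
  have hi0 : ∫ ω, ⟪f, Y ω⟫ ∂P = 0 := by
    rw [integral_inner (h2.integrable one_le_two), h0, inner_zero_right]
  have hσ := sigmaSq_eq h2 h0 f
  simp only [xiFun]
  rw [integral_add, integral_add, integral_sub, integral_add, integral_sub, integral_mul_const,
    integral_const_mul, integral_sub, integral_sub, hi0, ← hσ]
  · simp
  all_goals fun_prop

end Linearization

/-- Separability of `L²_Q` is what the measurability criterion and the central limit theorem
require. -/
instance instSecondCountableTopologyL2Q {H : Type*} [MeasurableSpace H]
    [MeasurableSpace.CountablyGenerated H] (Q : Measure H) [SFinite Q] :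
    SecondCountableTopology (L2Q Q) :=
  haveI : Fact ((2 : ENNReal) ≠ ⊤) := ⟨by simp⟩
  Lp.SecondCountableTopology

/-! ### The random element `ξ(·, Y)` of `L²_Q` and its covariance -/

section XiClass

open scoped Topology ENNReal

variable {Ω : Type*} [MeasurableSpace Ω] {P : Measure Ω} [IsProbabilityMeasure P]
  {H : Type*} [NormedAddCommGroup H] [InnerProductSpace ℝ H] [CompleteSpace H]
  [SecondCountableTopology H] [MeasurableSpace H] [BorelSpace H] {Y : Ω → H}
  {Q : Measure H} [IsProbabilityMeasure Q]
  (hQ : Integrable (fun f : H => ‖f‖ ^ 4) Q)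
  (hY : AEMeasurable Y P) (h4 : Integrable (fun ω => ‖Y ω‖ ^ 4) P)
  (h2 : MemLp Y 2 P) (h0 : ∫ ω, Y ω ∂P = 0)

theorem memLp_one_add_norm_sq_comp {S : Type*} [MeasurableSpace S] {μ : Measure S}
    [IsFiniteMeasure μ] {Z : S → H} (hZ : AEMeasurable Z μ)
    (h4 : Integrable (fun s => ‖Z s‖ ^ 4) μ) : MemLp (fun s => 1 + ‖Z s‖ ^ 2) 2 μ := by
  have h1 : MemLp (fun _ : S => (1 : ℝ)) 2 μ := memLp_const 1
  have h3 : MemLp (fun s => ‖Z s‖ ^ 2) 2 μ := memLp_two_norm_sq hZ h4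
  exact MemLp.add (f := fun _ : S => (1 : ℝ)) (g := fun s => ‖Z s‖ ^ 2) h1 h3

include hQ in
theorem memLp_one_add_norm_sq : MemLp (fun f : H => 1 + ‖f‖ ^ 2) 2 Q :=
  memLp_one_add_norm_sq_comp (Z := fun f : H => f) aemeasurable_id hQ

include hQ hY h2 h0 in
theorem memLp_xiFun (x : H) : MemLp (fun f => xiFun P Y f x) 2 Q := by
  refine (memLp_one_add_norm_sq hQ).of_le_mul
    (c := (5 + ∫ ω, ‖Y ω‖ ^ 2 ∂P) * (1 + ‖x‖ ^ 2)) ?_ (.of_forall fun f => ?_)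
  · exact ((measurable_xiFun hY h2 h0).comp
      (measurable_id.prodMk measurable_const : Measurable fun f : H => (f, x))).aestronglyMeasurable
  · rw [Real.norm_eq_abs, Real.norm_eq_abs, abs_of_pos (by positivity : 0 < 1 + ‖f‖ ^ 2)]
    exact (abs_xiFun_le h2 h0 f x).trans_eq (by ring)

/-- The class of `ξ(·, x)` in `L²_Q`. -/
def xiClass {P : Measure Ω} {Y : Ω → H} {Q : Measure H}
    (hT : ∀ x, MemLp (fun f => xiFun P Y f x) 2 Q) (x : H) : L2Q Q :=
  (hT x).toLp _

variable (hT : ∀ x, MemLp (fun f => xiFun P Y f x) 2 Q)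

include hY h2 h0 in
theorem measurable_xiClass : Measurable (xiClass hT) := by
  have hF : Measurable (Function.uncurry fun x f => xiFun P Y f x) := by
    have := (measurable_xiFun hY h2 h0).comp (measurable_swap (α := H) (β := H))
    simpa only [Function.comp_def, Function.uncurry_def, Prod.fst_swap, Prod.snd_swap] using this
  exact measurable_toLp hF hT

theorem norm_toLp_le_mul {S : Type*} [MeasurableSpace S] {μ : Measure S} {u v : S → ℝ}
    (hu : MemLp u 2 μ) (hv : MemLp v 2 μ) {c : ℝ} (h : ∀ s, |u s| ≤ c * |v s|) :
    ‖hu.toLp u‖ ≤ c * ‖hv.toLp v‖ := by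
  refine Lp.norm_le_mul_norm_of_ae_le_mul ?_
  filter_upwards [hu.coeFn_toLp, hv.coeFn_toLp] with s hs hs'
  rw [hs, hs']
  exact h s

include hQ h2 h0 in
theorem exists_norm_xiClass_le : ∃ C, ∀ x, ‖xiClass hT x‖ ≤ C * |1 + ‖x‖ ^ 2| := by
  refine ⟨(5 + ∫ ω, ‖Y ω‖ ^ 2 ∂P) * ‖(memLp_one_add_norm_sq hQ).toLp _‖, fun x => ?_⟩
  have := norm_toLp_le_mul (hT x) (memLp_one_add_norm_sq hQ)
    (c := (5 + ∫ ω, ‖Y ω‖ ^ 2 ∂P) * |1 + ‖x‖ ^ 2|) fun f => ?_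
  · exact this.trans_eq (by ring)
  · rw [abs_of_pos (by positivity : 0 < 1 + ‖f‖ ^ 2), abs_of_pos (by positivity : 0 < 1 + ‖x‖ ^ 2)]
    exact (abs_xiFun_le h2 h0 f x).trans_eq (by ring)

include hQ hY h2 h0 h4 in
theorem memLp_xiClass : MemLp (fun ω => xiClass hT (Y ω)) 2 P := by
  obtain ⟨C, hC⟩ := exists_norm_xiClass_le hQ h2 h0 hT
  exact (memLp_one_add_norm_sq_comp hY h4).of_le_mul
    ((measurable_xiClass hY h2 h0 hT).comp_aemeasurable hY).aestronglyMeasurable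
    (.of_forall fun ω => hC (Y ω))

omit [IsProbabilityMeasure P] [CompleteSpace H] [SecondCountableTopology H] [BorelSpace H]
  [IsProbabilityMeasure Q] in
theorem inner_xiClass (x : H) (Φ : L2Q Q) :
    ⟪xiClass hT x, Φ⟫ = ∫ f, xiFun P Y f x * Φ f ∂Q := by
  rw [L2.inner_def]
  refine integral_congr_ae ?_
  filter_upwards [(hT x).coeFn_toLp] with f hf
  rw [xiClass, hf]
  simp [mul_comm]

include hY h2 h0 in
theorem aestronglyMeasurable_xiFun_comp {S : Type*} [MeasurableSpace S] {μ : Measure S} [SFinite μ]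
    {g : S → H} (hg : Measurable g) :
    AEStronglyMeasurable (fun p : Ω × S => xiFun P Y (g p.2) (Y p.1)) (P.prod μ) := by
  have h : AEMeasurable (fun p : Ω × S => (g p.2, Y p.1)) (P.prod μ) :=
    (hg.comp measurable_snd).aemeasurable.prodMk hY.comp_fst
  exact ((measurable_xiFun hY h2 h0).comp_aemeasurable h).aestronglyMeasurable

include hQ in
theorem integrable_one_add_norm_sq_mul (Φ : L2Q Q) :
    Integrable (fun f => (1 + ‖f‖ ^ 2) * |Φ f|) Q :=
  (memLp_one_add_norm_sq hQ).integrable_mul (Lp.memLp Φ).abs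

include hY h4 in
theorem integrable_one_add_norm_sq_comp_sq : Integrable (fun ω => (1 + ‖Y ω‖ ^ 2) ^ 2) P :=
  (memLp_one_add_norm_sq_comp hY h4).integrable_sq

include hQ hY h2 h0 in
theorem integral_xiClass_eq_zero (hint : Integrable (fun ω => xiClass hT (Y ω)) P) :
    ∫ ω, xiClass hT (Y ω) ∂P = 0 := by
  refine ext_inner_left ℝ fun Φ => ?_
  rw [inner_zero_right, ← integral_inner hint]
  simp_rw [real_inner_comm _ Φ, inner_xiClass]
  rw [integral_integral_swap]
  · simp_rw [integral_mul_const, integral_xiFun_eq_zero hY h2 h0]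
    simp
  · have hb : Integrable (fun ω => (5 + ∫ ω, ‖Y ω‖ ^ 2 ∂P) * (1 + ‖Y ω‖ ^ 2)) P :=
      ((integrable_const 1).add h2.norm.integrable_sq).const_mul _
    refine (hb.mul_prod (integrable_one_add_norm_sq_mul hQ Φ)).mono' ?_ (.of_forall fun p => ?_)
    · exact (aestronglyMeasurable_xiFun_comp hY h2 h0 measurable_id).mul
        (Lp.aestronglyMeasurable Φ).comp_snd
    · simp only [Function.uncurry]
      rw [norm_mul, Real.norm_eq_abs, Real.norm_eq_abs]
      calc _ ≤ (5 + ∫ ω, ‖Y ω‖ ^ 2 ∂P) * ((1 + ‖p.2‖ ^ 2) * (1 + ‖Y p.1‖ ^ 2)) * |Φ p.2| := by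
            gcongr; exact abs_xiFun_le h2 h0 _ _
        _ = _ := by ring

-- This domination justifies the exchange of integrals behind the covariance formula. The factor `1
-- + ‖Y‖²` occurs squared, which uses the full fourth moment of `Y`.
include hQ hY h2 h0 h4 in
theorem integrable_xiFun_mul_xiFun (Φ Ψ : L2Q Q) :
    Integrable (fun p : Ω × (H × H) => xiFun P Y p.2.1 (Y p.1) * xiFun P Y p.2.2 (Y p.1)
      * Φ p.2.1 * Ψ p.2.2) (P.prod (Q.prod Q)) := by
  have hb := ((integrable_one_add_norm_sq_comp_sq hY h4).const_mul
    ((5 + ∫ ω, ‖Y ω‖ ^ 2 ∂P) ^ 2)).mul_prod ((integrable_one_add_norm_sq_mul hQ Φ).mul_prod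
      (integrable_one_add_norm_sq_mul hQ Ψ))
  have hm : 0 ≤ ∫ ω, ‖Y ω‖ ^ 2 ∂P := integral_nonneg fun ω => by positivity
  refine hb.mono' ?_ (.of_forall fun p => ?_)
  · have h1 := (Lp.aestronglyMeasurable Φ).comp_fst (ν := Q)
    have h3 := (Lp.aestronglyMeasurable Ψ).comp_snd (μ := Q)
    exact (((aestronglyMeasurable_xiFun_comp hY h2 h0 measurable_fst).mul
      (aestronglyMeasurable_xiFun_comp hY h2 h0 measurable_snd)).mul h1.comp_snd).mul h3.comp_snd
  · rw [norm_mul, norm_mul, norm_mul]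
    simp only [Real.norm_eq_abs]
    calc _ ≤ ((5 + ∫ ω, ‖Y ω‖ ^ 2 ∂P) * ((1 + ‖p.2.1‖ ^ 2) * (1 + ‖Y p.1‖ ^ 2)))
          * ((5 + ∫ ω, ‖Y ω‖ ^ 2 ∂P) * ((1 + ‖p.2.2‖ ^ 2) * (1 + ‖Y p.1‖ ^ 2)))
          * |Φ p.2.1| * |Ψ p.2.2| := by
          gcongr
          · exact abs_xiFun_le h2 h0 _ _
          · exact abs_xiFun_le h2 h0 _ _
      _ = _ := by ring

omit [IsProbabilityMeasure P] [CompleteSpace H] [SecondCountableTopology H] [BorelSpace H]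
  [IsProbabilityMeasure Q] [InnerProductSpace ℝ H] in
theorem kernelStar_mul_eq {H : Type*} [NormedAddCommGroup H] [InnerProductSpace ℝ H]
    {Y : Ω → H} (f g : H) (a b : ℝ) : kernelStar P Y f g * a * b
      = ∫ ω, xiFun P Y f (Y ω) * xiFun P Y g (Y ω) * a * b ∂P := by
  rw [kernelStar, integral_mul_const, integral_mul_const]

include hQ hY h2 h0 h4 in
theorem integrable_kernelStar_mul (Φ Ψ : L2Q Q) :
    Integrable (fun p : H × H => kernelStar P Y p.1 p.2 * Φ p.1 * Ψ p.2) (Q.prod Q) := by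
  simp_rw [kernelStar_mul_eq]
  exact (integrable_xiFun_mul_xiFun hQ hY h4 h2 h0 Φ Ψ).integral_prod_right

include hQ hY h2 h0 h4 in
theorem integral_inner_xiClass_mul (Φ Ψ : L2Q Q) :
    ∫ ω, ⟪xiClass hT (Y ω), Φ⟫ * ⟪xiClass hT (Y ω), Ψ⟫ ∂P
      = ∫ p : H × H, kernelStar P Y p.1 p.2 * Φ p.1 * Ψ p.2 ∂(Q.prod Q) := by
  simp_rw [kernelStar_mul_eq, inner_xiClass, ← integral_prod_mul]
  rw [integral_integral_swap]
  · congr 1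
    ext p
    congr 1
    ext ω
    ring
  · refine (integrable_xiFun_mul_xiFun hQ hY h4 h2 h0 Φ Ψ).congr (.of_forall fun p => ?_)
    simp only [Function.uncurry]
    ring

end XiClass

/-! ### Pointwise expansion of the statistic -/

section DeterministicBounds

open scoped Topology ENNReal TensorProduct

/-- The Taylor remainder is quadratic for nearby arguments but only linear for distant ones. A
purely quadratic bound would later demand eighth moments of `Q`. Factoring out the larger
exponential reduces both cases to a function of the gap alone. -/
theorem abs_exp_neg_sub_taylor_le {u v : ℝ} (hu : 0 ≤ u) (hv : 0 ≤ v) :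
    |Real.exp (-u) - Real.exp (-v) + Real.exp (-v) * (u - v)| ≤ |u - v| * min 1 |u - v| := by
  have hev : Real.exp (-v) ≤ 1 := Real.exp_le_one_iff.2 (by linarith)
  have heu : Real.exp (-u) ≤ 1 := Real.exp_le_one_iff.2 (by linarith)
  have hev0 := Real.exp_pos (-v)
  have heu0 := Real.exp_pos (-u)
  rcases le_total v u with h | h
  · obtain ⟨w, rfl⟩ : ∃ w, u = v + w := ⟨u - v, by ring⟩
    have hw : 0 ≤ w := by linarith
    have hfac : Real.exp (-(v + w)) - Real.exp (-v) + Real.exp (-v) * (v + w - v)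
        = Real.exp (-v) * (Real.exp (-w) - 1 + w) := by
      rw [neg_add, Real.exp_add]; ring
    have h1 : 0 ≤ Real.exp (-w) - 1 + w := by linarith [Real.add_one_le_exp (-w)]
    have h2 : Real.exp (-w) ≤ 1 := Real.exp_le_one_iff.2 (by linarith)
    have h3 : Real.exp (-w) * (1 + w) ≤ 1 := by
      have := Real.add_one_le_exp w
      calc Real.exp (-w) * (1 + w) ≤ Real.exp (-w) * Real.exp w := by gcongr; linarith
        _ = 1 := by rw [← Real.exp_add]; simp
    have h4 : Real.exp (-w) - 1 + w ≤ w * min 1 w := by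
      rcases le_total w 1 with hw1 | hw1
      · rw [min_eq_right hw1]; nlinarith [Real.exp_pos (-w), pow_nonneg hw 3]
      · rw [min_eq_left hw1]; linarith
    rw [hfac, abs_of_nonneg (by positivity), add_sub_cancel_left, abs_of_nonneg hw]
    exact (mul_le_of_le_one_left h1 hev).trans h4
  · obtain ⟨r, rfl⟩ : ∃ r, v = u + r := ⟨v - u, by ring⟩
    have hr : 0 ≤ r := by linarith
    have hfac : Real.exp (-u) - Real.exp (-(u + r)) + Real.exp (-(u + r)) * (u - (u + r))
        = Real.exp (-u) * (1 - Real.exp (-r) * (1 + r)) := by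
      rw [neg_add, Real.exp_add]; ring
    have h1 : Real.exp (-r) * (1 + r) ≤ 1 := by
      have := Real.add_one_le_exp r
      calc Real.exp (-r) * (1 + r) ≤ Real.exp (-r) * Real.exp r := by gcongr; linarith
        _ = 1 := by rw [← Real.exp_add]; simp
    have h2 := Real.add_one_le_exp (-r)
    have h3 : 1 - Real.exp (-r) * (1 + r) ≤ r * min 1 r := by
      rcases le_total r 1 with hr1 | hr1
      · rw [min_eq_right hr1]; nlinarith
      · rw [min_eq_left hr1]; nlinarith [mul_nonneg (Real.exp_pos (-r)).le hr]
    have h4 : |u - (u + r)| = r := by rw [abs_sub_comm]; simpa using hr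
    rw [hfac, abs_of_nonneg (mul_nonneg heu0.le (by linarith)), h4]
    exact (mul_le_of_le_one_left (by linarith) heu).trans h3

theorem abs_sin_sub_le (b : ℝ) : |Real.sin b - b| ≤ 2 * b ^ 2 := by
  rcases le_total |b| 1 with h | h
  · have h1 := Real.sin_bound h
    have h2 : |b| ^ 2 = b ^ 2 := sq_abs b
    have h3 : |b ^ 3 / 6| ≤ b ^ 2 := by
      rw [abs_div, abs_pow, abs_of_pos (by norm_num : (0 : ℝ) < 6)]
      nlinarith [abs_nonneg b, sq_nonneg b]
    have h4 : |b| ^ 5 / 100 ≤ b ^ 2 := by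
      have : |b| ^ 5 ≤ b ^ 2 := by
        rw [← h2]; exact pow_le_pow_of_le_one (abs_nonneg b) h (by norm_num)
      nlinarith [sq_nonneg b]
    rw [abs_le] at h1 h3 ⊢
    constructor <;> linarith
  · have h1 : |Real.sin b| ≤ |b| := Real.abs_sin_le_abs
    have h2 : |b| ≤ b ^ 2 := by rw [← sq_abs]; nlinarith
    exact (abs_sub _ _).trans (by linarith)

theorem abs_one_sub_cos_le (b : ℝ) : |Real.cos b - 1| ≤ b ^ 2 / 2 := by
  have h1 := Real.one_sub_sq_div_two_le_cos (x := b)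
  have h2 := Real.cos_le_one b
  rw [abs_le]
  constructor <;> linarith

/-- Here `w - b ^ 2` is the sample variance along `f` and `v` the true one. The cosine, the sine and
the replacement of `w - b ^ 2` by `w` in the exponential cost `b²`, `4b²` and `b²/2`, together at
most `6b²`. -/
theorem abs_linearization_remainder_le {C S D b v w : ℝ} (hC : |C| ≤ 1) (hS : |S| ≤ 1)
    (hv : 0 ≤ v) (hw : 0 ≤ w) (hwb : 0 ≤ w - b ^ 2) :
    |(Real.cos b - 1) * (C + S) + (Real.sin b - b) * (S - C) + b * (S - C - D)
      - (Real.exp (-(1 / 2) * (w - b ^ 2)) - Real.exp (-(1 / 2) * v)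
        + 1 / 2 * Real.exp (-(1 / 2) * v) * (w - v))|
    ≤ 6 * b ^ 2 + |b| * |S - C - D| + |w - v| * min 1 |w - v| := by
  have h1 : |(Real.cos b - 1) * (C + S)| ≤ b ^ 2 / 2 * 2 := by
    rw [abs_mul]
    gcongr
    · exact abs_one_sub_cos_le b
    · exact (abs_add_le _ _).trans (by linarith)
  have h2 : |(Real.sin b - b) * (S - C)| ≤ 2 * b ^ 2 * 2 := by
    rw [abs_mul]
    gcongr
    · exact abs_sin_sub_le b
    · exact (abs_sub _ _).trans (by linarith)
  have h3 : |b * (S - C - D)| = |b| * |S - C - D| := abs_mul _ _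
  have h4 : |Real.exp (-(1 / 2) * (w - b ^ 2)) - Real.exp (-(1 / 2) * w)| ≤ b ^ 2 / 2 := by
    have e1 : Real.exp (-(1 / 2) * w) = Real.exp (-(1 / 2) * (w - b ^ 2)) * Real.exp (-(b ^ 2 / 2)) := by
      rw [← Real.exp_add]; ring_nf
    have e2 : Real.exp (-(1 / 2) * (w - b ^ 2)) ≤ 1 := Real.exp_le_one_iff.2 (by linarith)
    have e3 := Real.exp_pos (-(1 / 2) * (w - b ^ 2))
    have e4 := Real.add_one_le_exp (-(b ^ 2 / 2))
    have e5 : Real.exp (-(b ^ 2 / 2)) ≤ 1 := Real.exp_le_one_iff.2 (by nlinarith [sq_nonneg b])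
    rw [e1, abs_of_nonneg (by nlinarith)]
    nlinarith
  have h5 : |Real.exp (-(1 / 2) * w) - Real.exp (-(1 / 2) * v)
      + 1 / 2 * Real.exp (-(1 / 2) * v) * (w - v)| ≤ |w - v| * min 1 |w - v| := by
    have := abs_exp_neg_sub_taylor_le (u := w / 2) (v := v / 2) (by linarith) (by linarith)
    have e1 : |w / 2 - v / 2| ≤ |w - v| := by
      rw [← sub_div, abs_div, abs_of_pos (by norm_num : (0 : ℝ) < 2)]
      linarith [abs_nonneg (w - v)]
    have e2 : |w / 2 - v / 2| * min 1 |w / 2 - v / 2| ≤ |w - v| * min 1 |w - v| := by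
      gcongr
    refine le_trans (le_of_eq ?_) (this.trans e2)
    congr 1
    ring_nf
  have h6 := abs_add_le ((Real.cos b - 1) * (C + S)) ((Real.sin b - b) * (S - C))
  have h7 : |b * (S - C - D)| ≤ |b| * |S - C - D| := h3.le
  rw [abs_le] at h1 h2 h4 h5 h7 ⊢
  constructor <;> linarith

/-- A Hilbert space containing the symmetric squares `x ⊗ x`. -/
theorem exists_tensorSquare.{w} (H : Type w) [NormedAddCommGroup H] [InnerProductSpace ℝ H] :
    ∃ (K : Type w) (_ : NormedAddCommGroup K) (_ : InnerProductSpace ℝ K) (_ : CompleteSpace K)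
      (τ : H → K), Continuous τ ∧ ∀ f x, ⟪τ f, τ x⟫ = ⟪f, x⟫ ^ 2 := by
  refine ⟨UniformSpace.Completion (H ⊗[ℝ] H), inferInstance, inferInstance, inferInstance,
    fun x => ((x ⊗ₜ[ℝ] x : H ⊗[ℝ] H) : UniformSpace.Completion (H ⊗[ℝ] H)), ?_, fun f x => ?_⟩
  · exact (UniformSpace.Completion.continuous_coe _).comp
      (TensorProduct.continuous_tmul.comp (continuous_id.prodMk continuous_id))
  · rw [UniformSpace.Completion.inner_coe, TensorProduct.inner_tmul, sq]

variable {H : Type*} [NormedAddCommGroup H] [InnerProductSpace ℝ H]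

theorem VnStar_eq {n : ℕ} (hn : n ≠ 0) (y : ℕ → H) (f : H) :
    VnStar n y f = (n : ℝ)⁻¹ * ∑ j ∈ Finset.range n,
        (Real.cos ⟪f, y j - sampleMean n y⟫ + Real.sin ⟪f, y j - sampleMean n y⟫)
      - Real.exp (-(1 / 2) * ⟪sampleCov n y f, f⟫) := by
  have hn' : (n : ℝ) ≠ 0 := by exact_mod_cast hn
  have hs : √(n : ℝ) ≠ 0 := by positivity
  have hsq : √(n : ℝ) * √(n : ℝ) = n := Real.mul_self_sqrt (by positivity)
  rw [VnStar, Vn, Finset.sum_sub_distrib, Finset.sum_const, Finset.card_range, nsmul_eq_mul,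
    one_div, mul_comm, div_eq_mul_inv, mul_assoc, ← mul_inv, hsq]
  field_simp

theorem inner_sampleMean (n : ℕ) (y : ℕ → H) (f : H) :
    ⟪f, sampleMean n y⟫ = (n : ℝ)⁻¹ * ∑ j ∈ Finset.range n, ⟪f, y j⟫ := by
  rw [sampleMean, inner_smul_right, inner_sum]

theorem inner_sampleCov_eq_sum (n : ℕ) (y : ℕ → H) (f : H) :
    ⟪sampleCov n y f, f⟫
      = (n : ℝ)⁻¹ * ∑ j ∈ Finset.range n, (⟪f, y j⟫ - ⟪f, sampleMean n y⟫) ^ 2 := by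
  rw [sampleCov, real_inner_smul_left, sum_inner]
  congr 1
  refine Finset.sum_congr rfl fun j _ => ?_
  rw [real_inner_smul_left, real_inner_comm, inner_sub_right, sq]

theorem inner_sampleCov_nonneg (n : ℕ) (y : ℕ → H) (f : H) : 0 ≤ ⟪sampleCov n y f, f⟫ := by
  rw [inner_sampleCov_eq_sum]
  positivity

theorem inner_sampleCov {n : ℕ} (hn : n ≠ 0) (y : ℕ → H) (f : H) :
    ⟪sampleCov n y f, f⟫ = (n : ℝ)⁻¹ * ∑ j ∈ Finset.range n, ⟪f, y j⟫ ^ 2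
      - ⟪f, sampleMean n y⟫ ^ 2 := by
  have hn' : (n : ℝ) ≠ 0 := by exact_mod_cast hn
  have hb : ∑ j ∈ Finset.range n, ⟪f, y j⟫ = n * ⟪f, sampleMean n y⟫ := by
    rw [inner_sampleMean]; field_simp
  rw [inner_sampleCov_eq_sum]
  simp_rw [sub_sq]
  rw [Finset.sum_add_distrib, Finset.sum_sub_distrib, ← Finset.sum_mul, ← Finset.mul_sum, hb,
    Finset.sum_const, Finset.card_range, nsmul_eq_mul]
  field_simp
  ring

theorem abs_average_le_one {n : ℕ} {g : ℕ → ℝ} (hg : ∀ j, |g j| ≤ 1) :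
    |(n : ℝ)⁻¹ * ∑ j ∈ Finset.range n, g j| ≤ 1 := by
  rw [abs_mul, abs_of_nonneg (by positivity : (0 : ℝ) ≤ (n : ℝ)⁻¹)]
  calc _ ≤ (n : ℝ)⁻¹ * ∑ j ∈ Finset.range n, |g j| := by
        gcongr; exact Finset.abs_sum_le_sum_abs _ _
    _ ≤ (n : ℝ)⁻¹ * ∑ j ∈ Finset.range n, 1 := by gcongr; exact hg _
    _ ≤ 1 := by simpa using inv_mul_le_one (a := (n : ℝ))

/-- The pointwise error of the linearization of `√n (V_n^⋆ - z)`. -/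
theorem abs_linearization_error_le {Ω : Type*} [MeasurableSpace Ω] {P : Measure Ω} {Y : Ω → H}
    (n : ℕ) (y : ℕ → H) (f : H) (hσ : 0 ≤ sigmaSq P Y f) :
    |√(n : ℝ) * (VnStar n y f - zFun P Y f)
        - (√(n : ℝ))⁻¹ * ∑ j ∈ Finset.range n, xiFun P Y f (y j)|
    ≤ √(n : ℝ) * (6 * ⟪f, sampleMean n y⟫ ^ 2 + |⟪f, sampleMean n y⟫|
        * |(n : ℝ)⁻¹ * ∑ j ∈ Finset.range n, (Real.sin ⟪f, y j⟫ - Real.cos ⟪f, y j⟫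
            - ∫ ω, (Real.sin ⟪f, Y ω⟫ - Real.cos ⟪f, Y ω⟫) ∂P)|
        + |(n : ℝ)⁻¹ * ∑ j ∈ Finset.range n, (⟪f, y j⟫ ^ 2 - sigmaSq P Y f)|
          * min 1 |(n : ℝ)⁻¹ * ∑ j ∈ Finset.range n, (⟪f, y j⟫ ^ 2 - sigmaSq P Y f)|) := by
  rcases eq_or_ne n 0 with rfl | hn
  · simp
  have hn' : (n : ℝ) ≠ 0 := by exact_mod_cast hn
  have hs : √(n : ℝ) ≠ 0 := by positivity
  have hsq : √(n : ℝ) * √(n : ℝ) = n := Real.mul_self_sqrt (by positivity)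
  set b := ⟪f, sampleMean n y⟫ with hb
  set D := ∫ ω, (Real.sin ⟪f, Y ω⟫ - Real.cos ⟪f, Y ω⟫) ∂P
  set v := sigmaSq P Y f
  set C := (n : ℝ)⁻¹ * ∑ j ∈ Finset.range n, Real.cos ⟪f, y j⟫ with hC
  set S := (n : ℝ)⁻¹ * ∑ j ∈ Finset.range n, Real.sin ⟪f, y j⟫ with hS
  set w := (n : ℝ)⁻¹ * ∑ j ∈ Finset.range n, ⟪f, y j⟫ ^ 2 with hw
  have hconst : ∀ c : ℝ, (n : ℝ)⁻¹ * ∑ _j ∈ Finset.range n, c = c := fun c => by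
    rw [Finset.sum_const, Finset.card_range, nsmul_eq_mul]; field_simp
  have hcov : ⟪sampleCov n y f, f⟫ = w - b ^ 2 := inner_sampleCov hn y f
  have hE : (n : ℝ)⁻¹ * ∑ j ∈ Finset.range n, (Real.sin ⟪f, y j⟫ - Real.cos ⟪f, y j⟫ - D)
      = S - C - D := by
    rw [Finset.sum_sub_distrib, Finset.sum_sub_distrib, mul_sub, mul_sub, hconst]
  have hd : (n : ℝ)⁻¹ * ∑ j ∈ Finset.range n, (⟪f, y j⟫ ^ 2 - v) = w - v := by
    rw [Finset.sum_sub_distrib, mul_sub, hconst]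
  -- Addition formulas for `cos` and `sin` of `⟪f, y j⟫ - b`, averaged over `j`.
  have hV : VnStar n y f = Real.cos b * (C + S) + Real.sin b * (S - C)
      - Real.exp (-(1 / 2) * (w - b ^ 2)) := by
    rw [VnStar_eq hn, hcov]
    congr 1
    simp_rw [inner_sub_right, ← hb, Real.cos_sub, Real.sin_sub]
    simp only [Finset.sum_add_distrib, Finset.sum_sub_distrib, ← Finset.sum_mul]
    rw [hC, hS]
    ring
  have hmean : (n : ℝ)⁻¹ * ∑ j ∈ Finset.range n, ⟪f, y j⟫ = b := (inner_sampleMean n y f).symm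
  have hξ : (n : ℝ)⁻¹ * ∑ j ∈ Finset.range n, xiFun P Y f (y j)
      = C - (∫ ω, Real.cos ⟪f, Y ω⟫ ∂P) + S - (∫ ω, Real.sin ⟪f, Y ω⟫ ∂P) + b * D
        + 1 / 2 * Real.exp (-(1 / 2) * v) * (w - v) := by
    have hsplit : ∀ j, xiFun P Y f (y j) = Real.cos ⟪f, y j⟫ + Real.sin ⟪f, y j⟫ + D * ⟪f, y j⟫
        + 1 / 2 * Real.exp (-(1 / 2) * v) * ⟪f, y j⟫ ^ 2
        + (-(∫ ω, Real.cos ⟪f, Y ω⟫ ∂P) - (∫ ω, Real.sin ⟪f, Y ω⟫ ∂P)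
          - 1 / 2 * Real.exp (-(1 / 2) * v) * v) := fun j => by
      rw [xiFun]; ring
    simp_rw [hsplit, Finset.sum_add_distrib, ← Finset.mul_sum, mul_add, hconst]
    linear_combination D * hmean - hC - hS - (1 / 2 * Real.exp (-(1 / 2) * v)) * hw
  have hroot : (√(n : ℝ))⁻¹ * ∑ j ∈ Finset.range n, xiFun P Y f (y j)
      = √(n : ℝ) * ((n : ℝ)⁻¹ * ∑ j ∈ Finset.range n, xiFun P Y f (y j)) := by
    rw [← mul_assoc, ← div_eq_mul_inv, Real.sqrt_div_self', one_div]
  rw [hroot, ← mul_sub, abs_mul, abs_of_nonneg (Real.sqrt_nonneg _), hE, hd]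
  gcongr
  have hkey := abs_linearization_remainder_le (C := C) (S := S) (D := D) (b := b) (v := v) (w := w)
    (abs_average_le_one fun j => Real.abs_cos_le_one _)
    (abs_average_le_one fun j => Real.abs_sin_le_one _) hσ (by positivity)
    (hcov ▸ inner_sampleCov_nonneg n y f)
  refine le_trans (le_of_eq ?_) hkey
  rw [hξ, hV, zFun]
  congr 1
  ring

theorem sampleMean_sub_const {n : ℕ} (hn : n ≠ 0) (x : ℕ → H) (c : H) :
    sampleMean n (fun j => x j - c) = sampleMean n x - c := by
  have hn' : (n : ℝ) ≠ 0 := by exact_mod_cast hn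
  rw [sampleMean, sampleMean, Finset.sum_sub_distrib, Finset.sum_const, Finset.card_range, smul_sub,
    ← Nat.cast_smul_eq_nsmul ℝ, smul_smul, inv_mul_cancel₀ hn', one_smul]

/-- Data enter only through deviations from the sample mean; this is what permits centring. For `n =
0` both sides vanish. -/
theorem VnStar_sub_const (n : ℕ) (x : ℕ → H) (c f : H) :
    VnStar n (fun j => x j - c) f = VnStar n x f := by
  rcases eq_or_ne n 0 with rfl | hn
  · simp [VnStar]
  simp [VnStar, Vn, sampleCov, sampleMean_sub_const hn]

theorem abs_VnStar_le (n : ℕ) (y : ℕ → H) (f : H) : |VnStar n y f| ≤ 3 := by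
  rcases eq_or_ne n 0 with rfl | hn
  · simp [VnStar]
  rw [VnStar_eq hn, Finset.sum_add_distrib, mul_add]
  have h1 := abs_average_le_one (n := n) (g := fun j => Real.cos ⟪f, y j - sampleMean n y⟫)
    fun j => Real.abs_cos_le_one _
  have h2 := abs_average_le_one (n := n) (g := fun j => Real.sin ⟪f, y j - sampleMean n y⟫)
    fun j => Real.abs_sin_le_one _
  have h3 : Real.exp (-(1 / 2) * ⟪sampleCov n y f, f⟫) ≤ 1 :=
    Real.exp_le_one_iff.2 (by linarith [inner_sampleCov_nonneg n y f])
  have h4 := Real.exp_pos (-(1 / 2) * ⟪sampleCov n y f, f⟫)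
  rw [abs_le] at h1 h2 ⊢
  constructor <;> linarith

theorem continuous_VnStar (n : ℕ) : Continuous fun p : (ℕ → H) × H => VnStar n p.1 p.2 := by
  unfold VnStar Vn sampleCov sampleMean
  fun_prop

end DeterministicBounds

/-! ### Laws of large numbers with rate, and the three remainders -/

section Averages

open scoped Topology ENNReal

variable {Ω : Type*} [MeasurableSpace Ω] {P : Measure Ω} [IsProbabilityMeasure P]

theorem eLpNorm_two_sq_eq {S : Type*} [MeasurableSpace S] {μ : Measure S} (g : S → ℝ) :
    eLpNorm g 2 μ ^ 2 = ∫⁻ s, ‖g s‖ₑ ^ 2 ∂μ := by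
  rw [eLpNorm_eq_lintegral_rpow_enorm_toReal (by simp) (by simp), ← ENNReal.rpow_natCast,
    ← ENNReal.rpow_mul]
  simp

theorem sqrt_mul_norm_average {E : Type*} [NormedAddCommGroup E] [InnerProductSpace ℝ E]
    (ζ : ℕ → Ω → E) (n : ℕ) (ω : Ω) :
    √(n : ℝ) * ‖(n : ℝ)⁻¹ • ∑ j ∈ Finset.range n, ζ j ω‖ = ‖normSum ζ n ω‖ := by
  rw [normSum, norm_smul, norm_smul, ← mul_assoc, norm_inv, norm_inv, Real.norm_eq_abs,
    Real.norm_eq_abs, abs_of_nonneg (Real.sqrt_nonneg _), abs_of_nonneg (Nat.cast_nonneg n),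
    ← div_eq_mul_inv, Real.sqrt_div_self', one_div]

section Hilbert

variable {E : Type*} [NormedAddCommGroup E] [InnerProductSpace ℝ E] [CompleteSpace E]
  [MeasurableSpace E] [BorelSpace E] {ζ : ℕ → Ω → E} {ζ₀ : Ω → E} (hindep : iIndepFun ζ P)
  (hident : ∀ j, IdentDistrib (ζ j) ζ₀ P P) (h2 : MemLp ζ₀ 2 P) (h0 : ∫ ω, ζ₀ ω ∂P = 0)

include hindep hident h2 h0 in
theorem lintegral_enorm_average_sq_le (n : ℕ) :
    ∫⁻ ω, ‖(n : ℝ)⁻¹ • ∑ j ∈ Finset.range n, ζ j ω‖ₑ ^ 2 ∂P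
      ≤ (∫⁻ ω, ‖ζ₀ ω‖ₑ ^ 2 ∂P) * ENNReal.ofReal (n : ℝ)⁻¹ := by
  have h : ∀ ω, ‖(n : ℝ)⁻¹ • ∑ j ∈ Finset.range n, ζ j ω‖ₑ ^ 2
      = ‖normSum ζ n ω‖ₑ ^ 2 * ENNReal.ofReal (n : ℝ)⁻¹ := by
    intro ω
    have h1 : (n : ℝ)⁻¹ • ∑ j ∈ Finset.range n, ζ j ω = (√(n : ℝ))⁻¹ • normSum ζ n ω := by
      rw [normSum, smul_smul, ← mul_inv, Real.mul_self_sqrt (Nat.cast_nonneg n)]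
    rw [h1, enorm_smul, mul_pow, mul_comm, Real.enorm_of_nonneg (by positivity),
      ← ENNReal.ofReal_pow (by positivity), inv_pow, Real.sq_sqrt (Nat.cast_nonneg n)]
  simp_rw [h]
  rw [lintegral_mul_const' _ _ ENNReal.ofReal_ne_top]
  exact mul_le_mul_left (lintegral_enorm_normSum_sq_le hindep hident h2 h0 n) _

include hident h2 in
theorem aestronglyMeasurable_sum (n : ℕ) :
    AEStronglyMeasurable (fun ω => ∑ j ∈ Finset.range n, ζ j ω) P :=
  Finset.aestronglyMeasurable_fun_sum _ fun j _ => ((hident j).memLp_iff.2 h2).1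

theorem tendsto_mul_ofReal_inv_natCast {c : ℝ≥0∞} (hc : c ≠ ∞) :
    Tendsto (fun n : ℕ => c * ENNReal.ofReal (n : ℝ)⁻¹) atTop (𝓝 0) := by
  have h1 : Tendsto (fun n : ℕ => ENNReal.ofReal (n : ℝ)⁻¹) atTop (𝓝 0) := by
    simpa [Function.comp_def] using (ENNReal.continuous_ofReal.tendsto 0).comp tendsto_inv_atTop_nhds_zero_nat
  simpa using ENNReal.Tendsto.const_mul h1 (.inr hc)

theorem lintegral_enorm_sq_ne_top (h2 : MemLp ζ₀ 2 P) : ∫⁻ ω, ‖ζ₀ ω‖ₑ ^ 2 ∂P ≠ ∞ := by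
  rw [lintegral_enorm_sq_eq_ofReal h2]; exact ENNReal.ofReal_ne_top

include hindep hident h2 h0 in
theorem tendstoZeroInProb_average :
    TendstoZeroInProb P fun n ω => ‖(n : ℝ)⁻¹ • ∑ j ∈ Finset.range n, ζ j ω‖ₑ := by
  refine tendstoZeroInProb_of_lintegral_sq
    (fun n => ((aestronglyMeasurable_sum hident h2 n).const_smul _).enorm) ?_
  exact tendsto_of_tendsto_of_tendsto_of_le_of_le tendsto_const_nhds
    (tendsto_mul_ofReal_inv_natCast (lintegral_enorm_sq_ne_top h2)) (fun _ => zero_le)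
    (lintegral_enorm_average_sq_le hindep hident h2 h0)

-- The common mechanism for the remainders: `√n` is absorbed by one average, which becomes bounded
-- in `L²`, so any second factor that tends to zero in probability suffices.
include hindep hident h2 h0 in
theorem tendstoZeroInProb_normSum_mul {B : ℕ → Ω → ℝ≥0∞} (hB : TendstoZeroInProb P B) :
    TendstoZeroInProb P fun n ω => ‖normSum ζ n ω‖ₑ * B n ω :=
  hB.mul_of_lintegral_sq_le
    (fun n => ((aestronglyMeasurable_sum hident h2 n).const_smul _).enorm)
    (lintegral_enorm_sq_ne_top h2) (lintegral_enorm_normSum_sq_le hindep hident h2 h0)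

end Hilbert

section Remainders

variable {H : Type*} [NormedAddCommGroup H] [InnerProductSpace ℝ H] [CompleteSpace H]
  [SecondCountableTopology H] [MeasurableSpace H] [BorelSpace H] {Y : Ω → H} {Ys : ℕ → Ω → H}
  {Q : Measure H} [IsProbabilityMeasure Q]
  (hQ : Integrable (fun f : H => ‖f‖ ^ 4) Q)
  (hY : AEMeasurable Y P) (h4 : Integrable (fun ω => ‖Y ω‖ ^ 4) P)
  (h2 : MemLp Y 2 P) (h0 : ∫ ω, Y ω ∂P = 0)
  (hident : ∀ j, IdentDistrib (Ys j) Y P P) (hindep : iIndepFun Ys P)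

-- Dominated convergence with dominating function `‖f‖²`, which is in `L²_Q`; the minimum with `1`
-- provides the domination.
include hQ in
theorem tendsto_eLpNorm_norm_sq_mul_min :
    Tendsto (fun t : ℝ≥0∞ => eLpNorm (fun f : H => ‖f‖ ^ 2 * min 1 (‖f‖ ^ 2 * t.toReal)) 2 Q)
      (𝓝 0) (𝓝 0) := by
  have hq := memLp_two_norm_sq (Z := fun f : H => f) (μ := Q) aemeasurable_id hQ
  have hlim : Tendsto (fun t : ℝ≥0∞ =>
      ∫⁻ f : H, ‖‖f‖ ^ 2 * min 1 (‖f‖ ^ 2 * t.toReal)‖ₑ ^ 2 ∂Q) (𝓝 0) (𝓝 0) := by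
    have := tendsto_lintegral_filter_of_dominated_convergence (μ := Q) (l := 𝓝 (0 : ℝ≥0∞))
      (F := fun t f => ‖‖f‖ ^ 2 * min 1 (‖f‖ ^ 2 * t.toReal)‖ₑ ^ 2) (f := fun _ : H => 0)
      (fun f : H => ‖‖f‖ ^ 2‖ₑ ^ 2) (.of_forall fun t => by fun_prop)
      (.of_forall fun t => .of_forall fun f => ?_) (lintegral_enorm_sq_ne_top hq)
      (.of_forall fun f => ?_)
    · simpa using this
    · refine pow_le_pow_left' ?_ 2
      rw [enorm_mul]
      refine mul_le_of_le_one_right zero_le ?_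
      rw [Real.enorm_of_nonneg (le_min one_pos.le (by positivity))]
      exact ENNReal.ofReal_le_one.2 (min_le_left _ _)
    · have h1 : Tendsto (fun t : ℝ≥0∞ => t.toReal) (𝓝 0) (𝓝 0) := by
        simpa using ENNReal.tendsto_toReal ENNReal.zero_ne_top
      have h3 : Tendsto (fun t : ℝ≥0∞ => ‖f‖ ^ 2 * min 1 (‖f‖ ^ 2 * t.toReal)) (𝓝 0)
          (𝓝 (‖f‖ ^ 2 * min 1 (‖f‖ ^ 2 * 0))) :=
        (tendsto_const_nhds.min (h1.const_mul _)).const_mul _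
      simpa using ENNReal.Tendsto.pow (n := 2) h3.enorm
  have hroot : Tendsto (fun t : ℝ≥0∞ =>
      (∫⁻ f : H, ‖‖f‖ ^ 2 * min 1 (‖f‖ ^ 2 * t.toReal)‖ₑ ^ 2 ∂Q) ^ (1 / 2 : ℝ)) (𝓝 0) (𝓝 0) := by
    have := (ENNReal.continuous_rpow_const (y := (1 / 2 : ℝ))).tendsto 0
    simpa [Function.comp_def] using this.comp hlim
  refine hroot.congr fun t => ?_
  rw [← eLpNorm_two_sq_eq, ← ENNReal.rpow_natCast, ← ENNReal.rpow_mul]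
  simp

include hQ h2 h0 hident hindep in
theorem tendstoZeroInProb_sq_inner_sampleMean : TendstoZeroInProb P fun n ω =>
    eLpNorm (fun f => √(n : ℝ) * (6 * ⟪f, sampleMean n fun j => Ys j ω⟫ ^ 2)) 2 Q := by
  have hq := memLp_two_norm_sq (Z := fun f : H => f) (μ := Q) aemeasurable_id hQ
  have hB : TendstoZeroInProb P fun n ω =>
      ‖(n : ℝ)⁻¹ • ∑ j ∈ Finset.range n, Ys j ω‖ₑ * eLpNorm (fun f : H => 6 * ‖f‖ ^ 2) 2 Q := by
    refine (tendstoZeroInProb_average hindep hident h2 h0).comp_tendsto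
      (h := fun t => t * eLpNorm (fun f : H => 6 * ‖f‖ ^ 2) 2 Q) ?_
    have := ENNReal.Tendsto.mul_const (tendsto_id (α := ℝ≥0∞) (x := 𝓝 0))
      (b := eLpNorm (fun f : H => 6 * ‖f‖ ^ 2) 2 Q) (.inr (hq.const_mul 6).eLpNorm_ne_top)
    simpa using this
  refine (tendstoZeroInProb_normSum_mul hindep hident h2 h0 hB).mono_ae
    fun n => .of_forall fun ω => ?_
  set m := (n : ℝ)⁻¹ • ∑ j ∈ Finset.range n, Ys j ω
  have hm : (sampleMean n fun j => Ys j ω) = m := rfl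
  have hle : ∀ f : H, ‖√(n : ℝ) * (6 * ⟪f, sampleMean n fun j => Ys j ω⟫ ^ 2)‖
      ≤ (‖normSum Ys n ω‖ * ‖m‖) * (6 * ‖f‖ ^ 2) := by
    intro f
    rw [hm, ← sqrt_mul_norm_average, Real.norm_eq_abs, abs_of_nonneg (by positivity)]
    calc √(n : ℝ) * (6 * ⟪f, m⟫ ^ 2) ≤ √(n : ℝ) * (6 * (‖f‖ * ‖m‖) ^ 2) := by
          rw [← sq_abs]
          gcongr
          exact abs_real_inner_le_norm _ _
      _ = _ := by ring
  refine (eLpNorm_mono_real hle).trans_eq ?_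
  have := eLpNorm_const_smul (‖normSum Ys n ω‖ * ‖m‖) (fun f : H => 6 * ‖f‖ ^ 2) 2 Q
  rw [enorm_mul, enorm_norm, enorm_norm, mul_assoc] at this
  exact this

omit [CompleteSpace H] in
include hY in
theorem measurable_sin_sub_cos_centred : Measurable fun p : H × H =>
    Real.sin ⟪p.1, p.2⟫ - Real.cos ⟪p.1, p.2⟫
      - ∫ ω, (Real.sin ⟪p.1, Y ω⟫ - Real.cos ⟪p.1, Y ω⟫) ∂P := by
  have h1 := (measurable_integral_comp_inner hY
    (Real.measurable_sin.sub Real.measurable_cos)).comp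
      (measurable_fst : Measurable (Prod.fst : H × H → H))
  have h3 : Measurable fun p : H × H => Real.sin ⟪p.1, p.2⟫ - Real.cos ⟪p.1, p.2⟫ := by fun_prop
  exact h3.sub h1

-- By Tonelli the expected squared `L²_Q` norm is the `Q`-integral of `‖f‖²` times the variance of
-- an average of terms bounded by `4`, hence at most `16 / n` times the second moment of `Q`.
include hQ hY hident hindep in
theorem tendstoZeroInProb_norm_mul_average_of_bounded {e : H → H → ℝ}
    (hem : Measurable fun p : H × H => e p.1 p.2) (heb : ∀ f x, ‖e f x‖ ≤ 4)
    (he0 : ∀ f, ∫ ω, e f (Y ω) ∂P = 0) : TendstoZeroInProb P fun n ω =>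
      eLpNorm (fun f : H => ‖f‖ * |(n : ℝ)⁻¹ * ∑ j ∈ Finset.range n, e f (Ys j ω)|) 2 Q := by
  have hef : ∀ f, Measurable (e f) := fun f =>
    hem.comp (measurable_const.prodMk measurable_id : Measurable fun x : H => (f, x))
  have heid : ∀ f j, IdentDistrib (fun ω => e f (Ys j ω)) (fun ω => e f (Y ω)) P P := fun f j =>
    (hident j).comp (hef f)
  have he2 : ∀ f, MemLp (fun ω => e f (Y ω)) 2 P := fun f =>
    .of_bound ((hef f).comp_aemeasurable hY).aestronglyMeasurable 4 (.of_forall fun ω => heb f _)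
  have hjoint : ∀ n : ℕ, AEMeasurable (fun p : Ω × H => ‖‖p.2‖ * |(n : ℝ)⁻¹ *
      ∑ j ∈ Finset.range n, e p.2 (Ys j p.1)|‖ₑ ^ 2) (P.prod Q) := by
    intro n
    have h1 : ∀ j, AEMeasurable (fun p : Ω × H => e p.2 (Ys j p.1)) (P.prod Q) := fun j =>
      hem.comp_aemeasurable
        (measurable_snd.aemeasurable.prodMk (hident j).aemeasurable_fst.comp_fst)
    have h3 : AEMeasurable (fun p : Ω × H => |(n : ℝ)⁻¹ *
      ∑ j ∈ Finset.range n, e p.2 (Ys j p.1)|) (P.prod Q) :=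
      ((Finset.aemeasurable_fun_sum _ fun j _ => h1 j).const_mul _).abs
    have h5 : AEMeasurable (fun p : Ω × H => ‖p.2‖) (P.prod Q) := by fun_prop
    exact ((h5.mul h3).enorm).pow_const 2
  refine tendstoZeroInProb_of_lintegral_sq (fun n => ?_) ?_
  · have h1 := (hjoint n).lintegral_prod_right'.pow_const (1 / 2 : ℝ)
    refine h1.congr (.of_forall fun ω => ?_)
    change (∫⁻ f, ‖‖f‖ * |(n : ℝ)⁻¹ * ∑ j ∈ Finset.range n, e f (Ys j ω)|‖ₑ ^ 2 ∂Q) ^ (1 / 2 : ℝ) = _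
    rw [← eLpNorm_two_sq_eq, ← ENNReal.rpow_natCast, ← ENNReal.rpow_mul]
    simp
  · have hQ2 : MemLp (fun f : H => ‖f‖) 2 Q :=
      (memLp_two_of_integrable_norm_pow_four (Z := fun f : H => f) aemeasurable_id hQ).norm
    have hc : (∫⁻ f : H, ‖‖f‖‖ₑ ^ 2 ∂Q) * 16 ≠ ∞ :=
      ENNReal.mul_ne_top (lintegral_enorm_sq_ne_top hQ2) (by simp)
    refine tendsto_of_tendsto_of_tendsto_of_le_of_le tendsto_const_nhds
      (tendsto_mul_ofReal_inv_natCast hc) (fun _ => zero_le) fun n => ?_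
    simp_rw [eLpNorm_two_sq_eq]
    rw [lintegral_lintegral_swap (hjoint n)]
    calc ∫⁻ f, ∫⁻ ω, ‖‖f‖ * |(n : ℝ)⁻¹ * ∑ j ∈ Finset.range n, e f (Ys j ω)|‖ₑ ^ 2 ∂P ∂Q
        ≤ ∫⁻ f : H, ‖‖f‖‖ₑ ^ 2 * (16 * ENNReal.ofReal (n : ℝ)⁻¹) ∂Q := by
          refine lintegral_mono fun f => ?_
          simp_rw [enorm_mul ‖f‖, mul_pow]
          rw [lintegral_const_mul' _ _ (by finiteness)]
          refine mul_le_mul_right ?_ _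
          have h1 := lintegral_enorm_average_sq_le (ζ := fun j ω => e f (Ys j ω))
            (ζ₀ := fun ω => e f (Y ω)) (hindep.comp (fun _ => e f) fun _ => hef f) (heid f) (he2 f)
            (he0 f) n
          simp_rw [← Real.norm_eq_abs, enorm_norm, ← smul_eq_mul]
          refine h1.trans (mul_le_mul_left ?_ _)
          calc ∫⁻ ω, ‖e f (Y ω)‖ₑ ^ 2 ∂P ≤ ∫⁻ _, 16 ∂P := by
                refine lintegral_mono fun ω => ?_
                have : ‖e f (Y ω)‖ₑ ≤ 4 := by
                  rw [← ofReal_norm]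
                  exact (ENNReal.ofReal_le_ofReal (heb f _)).trans_eq (by norm_num)
                exact (pow_le_pow_left' this 2).trans_eq (by norm_num)
            _ = 16 := by simp
      _ = _ := by
          rw [lintegral_mul_const' _ _ (by finiteness), mul_assoc]

include hQ hY hident hindep in
theorem tendstoZeroInProb_norm_mul_average : TendstoZeroInProb P fun n ω =>
    eLpNorm (fun f : H => ‖f‖ * |(n : ℝ)⁻¹ * ∑ j ∈ Finset.range n,
      (Real.sin ⟪f, Ys j ω⟫ - Real.cos ⟪f, Ys j ω⟫
        - ∫ ω, (Real.sin ⟪f, Y ω⟫ - Real.cos ⟪f, Y ω⟫) ∂P)|) 2 Q := by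
  have hbound : ∀ f x : H, |Real.sin ⟪f, x⟫ - Real.cos ⟪f, x⟫| ≤ 2 := fun f x => by
    have h1 := Real.abs_sin_le_one ⟪f, x⟫
    have h3 := Real.abs_cos_le_one ⟪f, x⟫
    exact (abs_sub _ _).trans (by linarith)
  refine tendstoZeroInProb_norm_mul_average_of_bounded hQ hY hident hindep
    (e := fun f x => Real.sin ⟪f, x⟫ - Real.cos ⟪f, x⟫
      - ∫ ω, (Real.sin ⟪f, Y ω⟫ - Real.cos ⟪f, Y ω⟫) ∂P)
    (measurable_sin_sub_cos_centred hY) (fun f x => ?_) fun f => ?_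
  · have h1 := norm_integral_le_of_norm_le_const (μ := P) (C := 2)
      (f := fun ω => Real.sin ⟪f, Y ω⟫ - Real.cos ⟪f, Y ω⟫) (.of_forall fun ω => hbound f _)
    rw [probReal_univ, mul_one, Real.norm_eq_abs] at h1
    exact (abs_sub _ _).trans (by linarith [hbound f x])
  · have hi : Integrable (fun ω => Real.sin ⟪f, Y ω⟫ - Real.cos ⟪f, Y ω⟫) P :=
      (integrable_sin_inner hY f).sub (integrable_cos_inner hY f)
    rw [integral_sub hi (integrable_const _)]
    simp

include hQ hY h2 h0 hident hindep in
theorem tendstoZeroInProb_inner_sampleMean_mul : TendstoZeroInProb P fun n ω =>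
    eLpNorm (fun f => √(n : ℝ) * (|⟪f, sampleMean n fun j => Ys j ω⟫|
      * |(n : ℝ)⁻¹ * ∑ j ∈ Finset.range n, (Real.sin ⟪f, Ys j ω⟫ - Real.cos ⟪f, Ys j ω⟫
        - ∫ ω, (Real.sin ⟪f, Y ω⟫ - Real.cos ⟪f, Y ω⟫) ∂P)|)) 2 Q := by
  refine (tendstoZeroInProb_normSum_mul hindep hident h2 h0
    (tendstoZeroInProb_norm_mul_average hQ hY hident hindep)).mono_ae
    fun n => .of_forall fun ω => ?_
  set r : H → ℝ := fun f => |(n : ℝ)⁻¹ * ∑ j ∈ Finset.range n,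
    (Real.sin ⟪f, Ys j ω⟫ - Real.cos ⟪f, Ys j ω⟫
      - ∫ ω, (Real.sin ⟪f, Y ω⟫ - Real.cos ⟪f, Y ω⟫) ∂P)| with hr
  have hr0 : ∀ f, 0 ≤ r f := fun f => abs_nonneg _
  have hle : ∀ f : H, ‖√(n : ℝ) * (|⟪f, sampleMean n fun j => Ys j ω⟫| * r f)‖
      ≤ ‖normSum Ys n ω‖ * (‖f‖ * r f) := by
    intro f
    have := hr0 f
    rw [← sqrt_mul_norm_average, Real.norm_eq_abs, abs_of_nonneg (by positivity)]
    calc √(n : ℝ) * (|⟪f, sampleMean n fun j => Ys j ω⟫| * r f)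
        ≤ √(n : ℝ) * (‖f‖ * ‖sampleMean n fun j => Ys j ω‖ * r f) := by
          gcongr
          exact abs_real_inner_le_norm _ _
      _ = _ := by rw [sampleMean]; ring
  refine (eLpNorm_mono_real hle).trans_eq ?_
  have := eLpNorm_const_smul ‖normSum Ys n ω‖ (fun f : H => ‖f‖ * r f) 2 Q
  rw [enorm_norm] at this
  exact this

include hQ hY h4 h2 h0 hident hindep in
theorem tendstoZeroInProb_sampleCov_remainder : TendstoZeroInProb P fun n ω =>
    eLpNorm (fun f => √(n : ℝ) *
      (|(n : ℝ)⁻¹ * ∑ j ∈ Finset.range n, (⟪f, Ys j ω⟫ ^ 2 - sigmaSq P Y f)|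
        * min 1 |(n : ℝ)⁻¹ * ∑ j ∈ Finset.range n, (⟪f, Ys j ω⟫ ^ 2 - sigmaSq P Y f)|)) 2 Q := by
  -- With `τ x = x ⊗ x` the quadratic form `⟪f, x⟫ ^ 2` becomes linear in `τ x`. A single random
  -- vector `Δ`, the centred average of the tensors, then controls the variance error for all `f` at
  -- once, by `‖f‖² ‖Δ‖`; the fourth moment of `Y` is the second moment of `τ Y`.
  obtain ⟨K, _, _, _, τ, hτc, hτ⟩ := exists_tensorSquare H
  borelize K
  have hτn : ∀ x, ‖τ x‖ = ‖x‖ ^ 2 := fun x => by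
    have h1 := hτ x x
    rw [real_inner_self_eq_norm_sq, real_inner_self_eq_norm_sq] at h1
    exact (sq_eq_sq₀ (norm_nonneg _) (by positivity)).1 h1
  have hτm : AEStronglyMeasurable (fun ω => τ (Y ω)) P :=
    hτc.comp_aestronglyMeasurable hY.aestronglyMeasurable
  have hτ2 : MemLp (fun ω => τ (Y ω)) 2 P :=
    (memLp_two_norm_sq hY h4).of_le hτm (.of_forall fun ω => by simp [hτn])
  set c := ∫ ω, τ (Y ω) ∂P with hc
  have hζc : Continuous fun x => τ x - c := hτc.sub continuous_const
  have hζ2 : MemLp (fun ω => τ (Y ω) - c) 2 P := hτ2.sub (memLp_const c)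
  have hζ0 : ∫ ω, (τ (Y ω) - c) ∂P = 0 := by
    rw [integral_sub (hτ2.integrable one_le_two) (integrable_const _)]
    simp [hc]
  have hζid : ∀ j, IdentDistrib (fun ω => τ (Ys j ω) - c) (fun ω => τ (Y ω) - c) P P := fun j =>
    (hident j).comp hζc.measurable
  have hζind : iIndepFun (fun j ω => τ (Ys j ω) - c) P :=
    hindep.comp (fun _ x => τ x - c) fun _ => hζc.measurable
  have hσ : ∀ f, sigmaSq P Y f = ⟪τ f, c⟫ := fun f => by
    rw [hc, ← integral_inner (hτ2.integrable one_le_two), sigmaSq_eq h2 h0]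
    simp_rw [hτ]
  have hB := (tendstoZeroInProb_average hζind hζid hζ2 hζ0).comp_tendsto
    (tendsto_eLpNorm_norm_sq_mul_min hQ)
  refine (tendstoZeroInProb_normSum_mul hζind hζid hζ2 hζ0 hB).mono_ae
    fun n => .of_forall fun ω => ?_
  set Δ := (n : ℝ)⁻¹ • ∑ j ∈ Finset.range n, (τ (Ys j ω) - c)
  have hd : ∀ f, |(n : ℝ)⁻¹ * ∑ j ∈ Finset.range n, (⟪f, Ys j ω⟫ ^ 2 - sigmaSq P Y f)|
      ≤ ‖f‖ ^ 2 * ‖Δ‖ := by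
    intro f
    have h1 : (n : ℝ)⁻¹ * ∑ j ∈ Finset.range n, (⟪f, Ys j ω⟫ ^ 2 - sigmaSq P Y f) = ⟪τ f, Δ⟫ := by
      simp_rw [Δ, inner_smul_right, inner_sum, inner_sub_right, hτ, hσ]
    rw [h1, ← hτn f]
    exact abs_real_inner_le_norm _ _
  have hle : ∀ f : H, ‖√(n : ℝ) *
      (|(n : ℝ)⁻¹ * ∑ j ∈ Finset.range n, (⟪f, Ys j ω⟫ ^ 2 - sigmaSq P Y f)|
        * min 1 |(n : ℝ)⁻¹ * ∑ j ∈ Finset.range n, (⟪f, Ys j ω⟫ ^ 2 - sigmaSq P Y f)|)‖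
      ≤ ‖normSum (fun j ω => τ (Ys j ω) - c) n ω‖ * (‖f‖ ^ 2 * min 1 (‖f‖ ^ 2 * ‖Δ‖)) := by
    intro f
    rw [← sqrt_mul_norm_average, Real.norm_eq_abs, abs_of_nonneg (by positivity)]
    calc _ ≤ √(n : ℝ) * (‖f‖ ^ 2 * ‖Δ‖ * min 1 (‖f‖ ^ 2 * ‖Δ‖)) := by
          gcongr
          · exact hd f
          · exact hd f
      _ = _ := by ring
  refine (eLpNorm_mono_real hle).trans_eq ?_
  have := eLpNorm_const_smul ‖normSum (fun j ω => τ (Ys j ω) - c) n ω‖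
    (fun f : H => ‖f‖ ^ 2 * min 1 (‖f‖ ^ 2 * ‖Δ‖)) 2 Q
  rw [enorm_norm] at this
  rw [toReal_enorm]
  exact this

end Remainders

end Averages

/-! ### The limit theorem for centred data -/

section CentredSample

open scoped Topology ENNReal

variable {Ω : Type*} [MeasurableSpace Ω] {P : Measure Ω} [IsProbabilityMeasure P]
  {H : Type*} [NormedAddCommGroup H] [InnerProductSpace ℝ H] [CompleteSpace H]
  [SecondCountableTopology H] [MeasurableSpace H] [BorelSpace H] {Y : Ω → H} {Ys : ℕ → Ω → H}
  {Q : Measure H} [IsProbabilityMeasure Q]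
  (hQ : Integrable (fun f : H => ‖f‖ ^ 4) Q)
  (hY : AEMeasurable Y P) (h4 : Integrable (fun ω => ‖Y ω‖ ^ 4) P)
  (h2 : MemLp Y 2 P) (h0 : ∫ ω, Y ω ∂P = 0)
  (hident : ∀ j, IdentDistrib (Ys j) Y P P) (hindep : iIndepFun Ys P)

include h2 h0 in
theorem abs_zFun_le (f : H) : |zFun P Y f| ≤ 3 := by
  have hC := abs_integral_le_one (P := P) (g := fun ω => Real.cos ⟪f, Y ω⟫)
    fun ω => Real.abs_cos_le_one _
  have hS := abs_integral_le_one (P := P) (g := fun ω => Real.sin ⟪f, Y ω⟫)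
    fun ω => Real.abs_sin_le_one _
  have he : Real.exp (-(1 / 2) * sigmaSq P Y f) ≤ 1 :=
    Real.exp_le_one_iff.2 (by linarith [sigmaSq_nonneg h2 h0 f])
  have he0 := Real.exp_pos (-(1 / 2) * sigmaSq P Y f)
  rw [zFun]
  rw [abs_le] at hC hS ⊢
  constructor <;> linarith

include hY h2 h0 in
theorem measurable_sqrt_mul_VnStar_sub_zFun (n : ℕ) :
    Measurable fun p : (ℕ → H) × H => √(n : ℝ) * (VnStar n p.1 p.2 - zFun P Y p.2) := by
  have h1 := (measurable_zFun hY h2 h0).comp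
    (measurable_snd : Measurable (Prod.snd : (ℕ → H) × H → H))
  exact ((continuous_VnStar n).measurable.sub h1).const_mul _

-- Both `V_n^⋆` and `z` are bounded by `3`, so membership in `L²_Q` holds for every data sequence,
-- without exceptional null sets.
include hY h2 h0 in
theorem memLp_sqrt_mul_VnStar_sub_zFun (n : ℕ) (x : ℕ → H) :
    MemLp (fun f => √(n : ℝ) * (VnStar n x f - zFun P Y f)) 2 Q := by
  refine .of_bound (C := √(n : ℝ) * 6) ?_ (.of_forall fun f => ?_)
  · exact ((measurable_sqrt_mul_VnStar_sub_zFun hY h2 h0 n).comp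
      (measurable_const.prodMk measurable_id : Measurable fun f : H => (x, f))).aestronglyMeasurable
  · rw [norm_mul, Real.norm_eq_abs, Real.norm_eq_abs, abs_of_nonneg (Real.sqrt_nonneg _)]
    gcongr
    exact (abs_sub _ _).trans (by linarith [abs_VnStar_le n x f, abs_zFun_le h2 h0 f])

/-- The class of `√n (V_n^⋆ - z)` in `L²_Q`. -/
def VnClass {P : Measure Ω} {Y : Ω → H} {Q : Measure H}
    (hV : ∀ (n : ℕ) (x : ℕ → H), MemLp (fun f => √(n : ℝ) * (VnStar n x f - zFun P Y f)) 2 Q)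
    (n : ℕ) (x : ℕ → H) : L2Q Q :=
  (hV n x).toLp _

variable (hV : ∀ (n : ℕ) (x : ℕ → H), MemLp (fun f => √(n : ℝ) * (VnStar n x f - zFun P Y f)) 2 Q)
  (hT : ∀ x, MemLp (fun f => xiFun P Y f x) 2 Q)

include hY h2 h0 in
theorem measurable_VnClass (n : ℕ) : Measurable (VnClass hV n) := by
  have hF : Measurable (Function.uncurry fun (x : ℕ → H) f =>
      √(n : ℝ) * (VnStar n x f - zFun P Y f)) := measurable_sqrt_mul_VnStar_sub_zFun hY h2 h0 n
  exact measurable_toLp hF (hV n)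

omit [IsProbabilityMeasure P] [CompleteSpace H] [SecondCountableTopology H] [BorelSpace H]
  [IsProbabilityMeasure Q] in
theorem coeFn_normSum_xiClass (n : ℕ) (ω : Ω) :
    (normSum (fun j ω => xiClass hT (Ys j ω)) n ω : L2Q Q)
      =ᵐ[Q] fun f => (√(n : ℝ))⁻¹ * ∑ j ∈ Finset.range n, xiFun P Y f (Ys j ω) := by
  have hs : ∀ N : ℕ, (∑ j ∈ Finset.range N, xiClass hT (Ys j ω) : L2Q Q)
      =ᵐ[Q] fun f => ∑ j ∈ Finset.range N, xiFun P Y f (Ys j ω) := by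
    intro N
    induction N with
    | zero =>
      simp only [Finset.range_zero, Finset.sum_empty]
      exact Lp.coeFn_zero ℝ 2 Q
    | succ N ih =>
      simp only [Finset.sum_range_succ]
      filter_upwards [Lp.coeFn_add (∑ j ∈ Finset.range N, xiClass hT (Ys j ω))
        (xiClass hT (Ys N ω)), ih, (hT (Ys N ω)).coeFn_toLp] with f h1 h2 h3
      rw [h1, Pi.add_apply, h2, xiClass, h3]
  filter_upwards [Lp.coeFn_smul (√(n : ℝ))⁻¹ (∑ j ∈ Finset.range n, xiClass hT (Ys j ω)), hs n]
    with f h1 h2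
  rw [normSum, h1, Pi.smul_apply, h2, smul_eq_mul]

omit [IsProbabilityMeasure P] [CompleteSpace H] in
theorem measurable_quadratic_remainder (a : ℝ) (m : H) :
    Measurable fun f : H => a * (6 * ⟪f, m⟫ ^ 2) := by
  fun_prop

include hY in
theorem measurable_bilinear_remainder (a : ℝ) (n : ℕ) (m : H) (x : ℕ → H) :
    Measurable fun f : H => a * (|⟪f, m⟫|
      * |(n : ℝ)⁻¹ * ∑ j ∈ Finset.range n, (Real.sin ⟪f, x j⟫ - Real.cos ⟪f, x j⟫
        - ∫ ω, (Real.sin ⟪f, Y ω⟫ - Real.cos ⟪f, Y ω⟫) ∂P)|) := by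
  have he : ∀ x : H, Measurable fun f => Real.sin ⟪f, x⟫ - Real.cos ⟪f, x⟫
      - ∫ ω, (Real.sin ⟪f, Y ω⟫ - Real.cos ⟪f, Y ω⟫) ∂P := fun x => by
    have h3 : Measurable fun f : H => Real.sin ⟪f, x⟫ - Real.cos ⟪f, x⟫ := by fun_prop
    exact h3.sub (measurable_integral_comp_inner hY
      (Real.measurable_sin.sub Real.measurable_cos))
  have hs : Measurable fun f => ∑ j ∈ Finset.range n, (Real.sin ⟪f, x j⟫ - Real.cos ⟪f, x j⟫
      - ∫ ω, (Real.sin ⟪f, Y ω⟫ - Real.cos ⟪f, Y ω⟫) ∂P) :=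
    Finset.measurable_fun_sum _ fun j _ => he (x j)
  have hb : Measurable fun f : H => ⟪f, m⟫ := by fun_prop
  exact (hb.abs.mul (hs.const_mul _).abs).const_mul _

include hY h2 h0 in
theorem measurable_cov_remainder (a : ℝ) (n : ℕ) (x : ℕ → H) :
    Measurable fun f : H => a *
      (|(n : ℝ)⁻¹ * ∑ j ∈ Finset.range n, (⟪f, x j⟫ ^ 2 - sigmaSq P Y f)|
        * min 1 |(n : ℝ)⁻¹ * ∑ j ∈ Finset.range n, (⟪f, x j⟫ ^ 2 - sigmaSq P Y f)|) := by
  have hσ := measurable_sigmaSq hY h2 h0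
  have he : ∀ x : H, Measurable fun f : H => ⟪f, x⟫ ^ 2 - sigmaSq P Y f := fun x =>
    (by fun_prop : Measurable fun f : H => ⟪f, x⟫ ^ 2).sub hσ
  have hs : Measurable fun f => (n : ℝ)⁻¹ * ∑ j ∈ Finset.range n,
      (⟪f, x j⟫ ^ 2 - sigmaSq P Y f) :=
    (Finset.measurable_fun_sum _ fun j _ => he (x j)).const_mul _
  exact (hs.abs.mul (measurable_const.min hs.abs)).const_mul _

omit [NormedAddCommGroup H] [InnerProductSpace ℝ H] [CompleteSpace H] [SecondCountableTopology H]
  [BorelSpace H] [IsProbabilityMeasure Q] in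
theorem eLpNorm_le_add_three {g u₁ u₂ u₃ : H → ℝ} (h₁ : Measurable u₁) (h₂ : Measurable u₂)
    (h₃ : Measurable u₃) (hle : ∀ᵐ f ∂Q, ‖g f‖ ≤ u₁ f + u₂ f + u₃ f) :
    eLpNorm g 2 Q ≤ eLpNorm u₁ 2 Q + eLpNorm u₂ 2 Q + eLpNorm u₃ 2 Q := by
  have h12 := eLpNorm_add_le h₁.aestronglyMeasurable h₂.aestronglyMeasurable one_le_two (μ := Q)
  have h123 := eLpNorm_add_le (h₁.add h₂).aestronglyMeasurable h₃.aestronglyMeasurable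
    one_le_two (μ := Q)
  exact (eLpNorm_mono_ae_real (g := u₁ + u₂ + u₃) hle).trans
    (h123.trans (add_le_add_left h12 _))

include hQ hY h4 h2 h0 hident hindep in
theorem tendstoZeroInProb_edist_linearization : TendstoZeroInProb P fun n ω =>
    edist (VnClass hV n fun j => Ys j ω) (normSum (fun j ω => xiClass hT (Ys j ω)) n ω) := by
  refine (((tendstoZeroInProb_sq_inner_sampleMean hQ h2 h0 hident hindep).add
    (tendstoZeroInProb_inner_sampleMean_mul hQ hY h2 h0 hident hindep)).add
    (tendstoZeroInProb_sampleCov_remainder hQ hY h4 h2 h0 hident hindep)).mono_ae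
    fun n => .of_forall fun ω => ?_
  rw [Lp.edist_def]
  refine eLpNorm_le_add_three (measurable_quadratic_remainder _ _)
    (measurable_bilinear_remainder hY _ n _ fun j => Ys j ω)
    (measurable_cov_remainder hY h2 h0 _ n fun j => Ys j ω) ?_
  filter_upwards [(hV n fun j => Ys j ω).coeFn_toLp, coeFn_normSum_xiClass hT n ω] with f h1 h3
  rw [Pi.sub_apply, VnClass, h1, h3, Real.norm_eq_abs]
  refine (abs_linearization_error_le n _ f (sigmaSq_nonneg h2 h0 f)).trans_eq ?_
  ring

include hQ hY h4 h2 h0 hident hindep hT in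
theorem exists_gaussian_tendstoInDistribution_VnClass :
    ∃ (μ : Measure (L2Q Q)) (_ : IsProbabilityMeasure μ),
      IsCentredGaussianWithKernel Q μ id (kernelStar P Y) ∧
      TendstoInDistribution (fun n ω => VnClass hV n fun j => Ys j ω) atTop id (fun _ => P) μ := by
  have hTm := measurable_xiClass hY h2 h0 hT
  have hζ2 := memLp_xiClass hQ hY h4 h2 h0 hT
  have hζ0 := integral_xiClass_eq_zero hQ hY h2 h0 hT (hζ2.integrable one_le_two)
  obtain ⟨μ, hμ, hgauss, hmean, hcov, hlim⟩ := exists_isGaussian_tendstoInDistribution_normSum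
    (ζ := fun j ω => xiClass hT (Ys j ω)) (ζ₀ := fun ω => xiClass hT (Y ω))
    (hindep.comp (fun _ => xiClass hT) fun _ => hTm) (fun j => (hident j).comp hTm) hζ2 hζ0
  have hL2 : MemLp (id : L2Q Q → L2Q Q) 2 μ := IsGaussian.memLp_id _ 2 (by simp)
  refine ⟨μ, hμ, ⟨⟨by simpa using hgauss⟩, hmean, fun Φ Ψ => ?_, fun Φ Ψ => ?_, fun Φ Ψ => ?_⟩, ?_⟩
  · exact (hL2.inner_const Φ).integrable_mul (hL2.inner_const Ψ)
  · exact integrable_kernelStar_mul hQ hY h4 h2 h0 Φ Ψ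
  · exact (hcov Φ Ψ).trans (integral_inner_xiClass_mul hQ hY h4 h2 h0 hT Φ Ψ)
  -- Slutsky: the statistic and the normalized sum of the `ξ` classes differ by a term that vanishes
  -- in probability.
  · refine tendstoInDistribution_of_tendstoInMeasure_sub _ id hlim ?_ fun n => ?_
    · intro ε hε
      refine (tendstoZeroInProb_edist_linearization hQ hY h4 h2 h0 hident hindep hV hT ε hε).congr
        fun n => ?_
      simp [edist_eq_enorm_sub]
    · exact (measurable_VnClass hY h2 h0 hV n).comp_aemeasurable
        (aemeasurable_pi_iff.2 fun j => (hident j).aemeasurable_fst)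

end CentredSample

end

/-! ### Reduction to centred data -/

theorem mainTheorem5
    {H : Type u} [NormedAddCommGroup H] [InnerProductSpace ℝ H] [CompleteSpace H]
    [SecondCountableTopology H] [MeasurableSpace H] [BorelSpace H]
    (Q : Measure H) [IsProbabilityMeasure Q]
    (hQ : Integrable (fun f : H => ‖f‖ ^ 4) Q)
    {Ω : Type v} [MeasurableSpace Ω] (P : Measure Ω) [IsProbabilityMeasure P]
    (X : Ω → H) (Xs : ℕ → Ω → H)
    (hident : ∀ j, IdentDistrib (Xs j) X P P)
    (hindep : iIndepFun Xs P)
    (hX : Integrable (fun ω => ‖X ω‖ ^ 4) P)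
    (Y : Ω → H) (hY : Y = fun ω => X ω - ∫ ω', X ω' ∂P) :
    ∃ (W : ℕ → Ω → L2Q Q)
      (Ω' : Type u) (_ : MeasurableSpace Ω') (P' : Measure Ω') (_ : IsProbabilityMeasure P')
      (V : Ω' → L2Q Q),
      (∀ n ω, W n ω =ᵐ[Q]
        fun f => √(n : ℝ) * (VnStar n (fun j => Xs j ω) f - zFun P Y f)) ∧
      IsCentredGaussianWithKernel Q P' V (kernelStar P Y) ∧
      TendstoInDistribution W atTop V (fun _ => P) P' := by
  set c := ∫ ω', X ω' ∂P with hc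
  have hXm : AEMeasurable X P := (hident 0).aemeasurable_snd
  have hX2 : MemLp X 2 P := memLp_two_of_integrable_norm_pow_four hXm hX
  have hYm : AEMeasurable Y P := by rw [hY]; exact hXm.sub_const c
  have h2 : MemLp Y 2 P := by rw [hY]; exact hX2.sub (memLp_const c)
  have h4 : Integrable (fun ω => ‖Y ω‖ ^ 4) P := by
    refine ((hX.add (integrable_const (‖c‖ ^ 4))).const_mul 8).mono' (by fun_prop)
      (.of_forall fun ω => ?_)
    rw [hY, norm_pow, norm_norm, Pi.add_apply]
    calc ‖X ω - c‖ ^ 4 ≤ (‖X ω‖ + ‖c‖) ^ 4 := by gcongr; exact norm_sub_le _ _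
      _ ≤ 2 ^ (4 - 1) * (‖X ω‖ ^ 4 + ‖c‖ ^ 4) := add_pow_le (norm_nonneg _) (norm_nonneg _) 4
      _ = 8 * (‖X ω‖ ^ 4 + ‖c‖ ^ 4) := by norm_num
  have h0 : ∫ ω, Y ω ∂P = 0 := by
    rw [hY, integral_sub (hX2.integrable one_le_two) (integrable_const c)]
    simp [hc]
  have hidentY : ∀ j, IdentDistrib (fun ω => Xs j ω - c) Y P P := fun j => by
    rw [hY]; exact (hident j).comp (u := fun x => x - c) (by fun_prop)
  have hindepY : iIndepFun (fun j ω => Xs j ω - c) P :=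
    hindep.comp (fun _ x => x - c) fun _ => by fun_prop
  have hV := memLp_sqrt_mul_VnStar_sub_zFun (Q := Q) hYm h2 h0
  obtain ⟨μ, hμ, hgauss, hlim⟩ := exists_gaussian_tendstoInDistribution_VnClass hQ hYm h4 h2 h0
    hidentY hindepY hV (memLp_xiFun hQ hYm h2 h0)
  -- The limit is realized as the identity on `L²_Q` itself, under the Gaussian law `μ`.
  refine ⟨fun n ω => VnClass hV n fun j => Xs j ω - c, L2Q Q, inferInstance, μ, hμ, id,
    fun n ω => ?_, hgauss, hlim⟩
  filter_upwards [(hV n fun j => Xs j ω - c).coeFn_toLp] with f hf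
  rw [VnClass, hf, VnStar_sub_const]
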